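/- Let $1<\alpha<2$, $1<p<\alpha$, $0<d<1-\frac1\alpha$, and let $\{L_\alpha(t)\}_{t\in\mathbb R}$ be a symmetric $\alpha$-stable (two-sided) motion with Lebesgue control measure on a probability space $(\Omega,\mathcal F,\mathbb P)$: $L_\alpha(0)=0$ a.s., the increments are independent, and $\mathbb E\,e^{i\theta(L_\alpha(t)-L_\alpha(s))}=e^{-(t-s)|\theta|^\alpha}$ for $s\le t$, $\theta\in\mathbb R$. A simple function is $\phi=\sum_{i=1}^{n-1}a_i\mathbf 1_{(t_i,t_{i+1}]}$ with $a_i\in\mathbb R$ and $t_1<\dots<t_n$, and for a process $X$ put $I_X(\phi)=\sum_{i=1}^{n-1}a_i\,[X(t_{i+1})-X(t_i)]$. For $f\in L^\alpha(\mathbb R)$, the stable integral $\int_{\mathbb R} f\,dL_\alpha$ is the limit in probability of $I_{L_\alpha}(\phi_n)$ for any simple functions $\phi_n\to f$ in $L^\alpha(\mathbb R)$. The linear fractional stable motion is $$M_d(t)=\frac1{\Gamma(d+1)}\int_{\mathbb R}\big[(t-x)_+^d-(-x)_+^d\big]\,dL_\alpha(x)\quad\text{a.s.},\qquad t\in\mathbb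 R .$$ For $g\in L^1(\mathbb R)\cap L^\alpha(\mathbb R)$ let $$(I_-^dg)(x)=\frac1{\Gamma(d)}\int_x^\infty g(t)(t-x)^{d-1}\,dt,\qquad \|g\|_{\alpha,p}=\mathbb E\big[|L_\alpha(1)|^p\big]^{1/p}\,\|I_-^dg\|_{L^\alpha(\mathbb R)},$$ and let $B_{\alpha,p}$ be $L^1(\mathbb R)\cap L^\alpha(\mathbb R)$ modulo the relation $f\sim g\iff\|f-g\|_{\alpha,p}=0$. **Theorem 3.1.** Let $g\in B_{\alpha,p}$. Then there is a sequence of simple functions $\phi_n$ with $\|\phi_n-g\|_{\alpha,p}\to0$. Moreover, there is a unique element $I_{M_d}(g)$ of $L^p(\Omega,\mathbb P)$, depending only on the class of $g$ in $B_{\alpha,p}$, such that for every sequence of simple functions $\phi_n$ with $\|\phi_n-g\|_{\alpha,p}\to0$ the integrals $I_{M_d}(\phi_n)$ lie in $L^p(\Omega,\mathbb P)$ and converge in $L^p(\Omega,\mathbb P)$ to $I_{M_d}(g)$. It satisfies the isometry $$\|I_{M_d}(g)\|_{L^p(\Omega,\mathbb P)}=\|g\|_{\alpha,p}=\mathbb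 E\big[|L_\alpha(1)|^p\big]^{1/p}\,\|I_-^dg\|_{L^\alpha(\mathbb R)},$$ where $\mathbb E[|L_\alpha(1)|^p]<\infty$ and $I_-^dg\in L^\alpha(\mathbb R)$. -/

import Mathlib

open MeasureTheory ProbabilityTheory Filter Topology
open scoped ENNReal

noncomputable section

namespace FracStable

/-- A law on the line is symmetric `α`-stable with scale `σ`, that is `S_α(σ, 0, 0)`, when its
characteristic function is `θ ↦ exp (-σ^α |θ|^α)`. -/
def IsSymmStable (α σ : ℝ) (μ : Measure ℝ) : Prop :=
  ∀ θ : ℝ, charFun μ θ = Complex.exp (-((σ ^ α * |θ| ^ α : ℝ) : ℂ))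

/-- A two-sided symmetric `α`-stable motion whose control measure is Lebesgue measure: it starts
at `0`, has independent increments, and `L t - L s` has law `S_α((t - s)^(1/α), 0, 0)`. -/
structure IsStableMotion {Ω : Type*} [MeasurableSpace Ω] (α : ℝ) (L : ℝ → Ω → ℝ)
    (P : Measure Ω) : Prop where
  measurable : ∀ t, Measurable (L t)
  zero : ∀ᵐ ω ∂P, L 0 ω = 0
  indep : HasIndepIncrements L P
  law : ∀ s t : ℝ, s ≤ t →
    IsSymmStable α ((t - s) ^ (1 / α)) (P.map (fun ω => L t ω - L s ω))

/-- Simple functions `∑ aᵢ 1_(tᵢ, tᵢ₊₁]` with `t₀ < t₁ < ⋯ < tₙ`. -/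
structure SimpleFn where
  n : ℕ
  t : Fin (n + 1) → ℝ
  strictMono : StrictMono t
  a : Fin n → ℝ

namespace SimpleFn

/-- The function `ℝ → ℝ` given by the data. -/
def toFun (φ : SimpleFn) (x : ℝ) : ℝ :=
  ∑ i : Fin φ.n, (Set.Ioc (φ.t i.castSucc) (φ.t i.succ)).indicator (fun _ => φ.a i) x

instance : CoeFun SimpleFn (fun _ => ℝ → ℝ) := ⟨toFun⟩

/-- The elementary integral `∑ aᵢ (X(tᵢ₊₁) - X(tᵢ))` with respect to a process `X`. -/
def integral {Ω : Type*} (φ : SimpleFn) (X : ℝ → Ω → ℝ) (ω : Ω) : ℝ :=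
  ∑ i : Fin φ.n, φ.a i * (X (φ.t i.succ) ω - X (φ.t i.castSucc) ω)

end SimpleFn

variable {Ω : Type*} [MeasurableSpace Ω]

/-- `X` is (a version of) the stable integral `∫ f dL`: the limit in probability of the elementary
integrals of any simple functions that converge to `f` in `L^α(ℝ)`. -/
def IsStableIntegral (α : ℝ) (L : ℝ → Ω → ℝ) (P : Measure Ω) (f : ℝ → ℝ) (X : Ω → ℝ) : Prop :=
  AEMeasurable X P ∧ ∀ φ : ℕ → SimpleFn,
    Tendsto (fun k => eLpNorm (fun x => φ k x - f x) (ENNReal.ofReal α) volume) atTop (𝓝 0) →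
    TendstoInMeasure P (fun k => (φ k).integral L) atTop X

open Classical in
/-- The stable integral `∫ f dL` for `f ∈ L^α(ℝ)` (a version of it; `0` if there is none). -/
def stableIntegral (α : ℝ) (L : ℝ → Ω → ℝ) (P : Measure Ω) (f : ℝ → ℝ) : Ω → ℝ :=
  if h : MemLp f (ENNReal.ofReal α) volume ∧ ∃ X : Ω → ℝ, IsStableIntegral α L P f X then
    h.2.choose
  else 0

/-- The moving-average kernel `x ↦ ((t - x)₊^d - (-x)₊^d) / Γ(d + 1)`. -/
def lfsmKernel (d t x : ℝ) : ℝ :=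
  1 / Real.Gamma (d + 1) * ((max (t - x) 0) ^ d - (max (-x) 0) ^ d)

/-- The linear fractional stable motion `M_d(t) = ∫ lfsmKernel d t dL`. -/
def lfsm (α d : ℝ) (L : ℝ → Ω → ℝ) (P : Measure Ω) (t : ℝ) : Ω → ℝ :=
  stableIntegral α L P (lfsmKernel d t)

/-- The right-sided Riemann-Liouville fractional integral `I_-^d g`. -/
def rightFracInt (d : ℝ) (g : ℝ → ℝ) (x : ℝ) : ℝ :=
  1 / Real.Gamma d * ∫ t in Set.Ioi x, g t * (t - x) ^ (d - 1)

/-- Membership in `L^1(ℝ) ∩ L^α(ℝ)`. -/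
def MemB (α : ℝ) (g : ℝ → ℝ) : Prop :=
  MemLp g 1 volume ∧ MemLp g (ENNReal.ofReal α) volume

/-- `‖g‖_{α,p} = E[|L(1)|^p]^(1/p) ‖I_-^d g‖_α`, with values in `[0, ∞]`, so that nothing is
presupposed about finiteness. -/
def normB (α p d : ℝ) (L : ℝ → Ω → ℝ) (P : Measure Ω) (g : ℝ → ℝ) : ℝ≥0∞ :=
  (∫⁻ ω, ENNReal.ofReal (|L 1 ω| ^ p) ∂P) ^ (1 / p) *
    eLpNorm (rightFracInt d g) (ENNReal.ofReal α) volume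

/-- The relation that `B_{α,p}` is the quotient of `L^1(ℝ) ∩ L^α(ℝ)` by. -/
def EquivB (α p d : ℝ) (L : ℝ → Ω → ℝ) (P : Measure Ω) (f g : ℝ → ℝ) : Prop :=
  normB α p d L P (fun x => f x - g x) = 0

end FracStable

end

/-! The integral against $M_d$ is the stable integral of a fractional integral: $I_{M_d}(g)=\int
I_-^d g\,dL_\alpha$.

For simple $\phi$, independence of increments shows that $I_{L_\alpha}(\phi)$ has the law of
$\|\phi\|_\alpha L_\alpha(1)$, so its $L^p$ norm is $\|L_\alpha(1)\|_p\|\phi\|_\alpha$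
(`SimpleFn.eLpNorm_integral`), where $\|L_\alpha(1)\|_p$ is finite because $p<\alpha$. By density of
simple functions and completeness of $L^p$, this isometry extends to $L^\alpha(\mathbb R)$
(`exists_isLpIntegral`, `IsLpIntegral.eLpNorm_eq`), and its values are the stable integrals.

The kernel of $M_d(v)-M_d(u)$ is $I_-^d\mathbf 1_{(u,v]}$ (`rightFracInt_indicator`). By linearity
$I_{M_d}(\phi)=\int I_-^d\phi\,dL_\alpha$, hence $\|I_{M_d}(\phi)-\int
I_-^dg\,dL_\alpha\|_p=\|\phi-g\|_{\alpha,p}$ exactly (`eLpNorm_integral_sub_eq_normB`). Convergence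
and uniqueness follow from this identity, and the norm formula from the isometry.

The analytic input is that $I_-^d$ maps $L^1\cap L^\alpha$ boundedly into $L^\alpha$
(`exists_eLpNorm_rightFracInt_le`). It makes the norm finite and reduces density in $B_{\alpha,p}$
to density of simple functions in $L^1\cap L^\alpha$. -/

noncomputable section

namespace FracStable

section

/-! ### Tails and moments of symmetric stable laws. -/

section StableLaw

variable {α p : ℝ} {μ : Measure ℝ}

lemma norm_one_sub_charFun_le {σ : ℝ} (hμ : IsSymmStable α σ μ) (hσ : 0 ≤ σ) (θ : ℝ) :
    ‖1 - charFun μ θ‖ ≤ σ ^ α * |θ| ^ α := by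
  have h0 : 0 ≤ σ ^ α * |θ| ^ α := by positivity
  rw [hμ θ, ← Complex.ofReal_neg, ← Complex.ofReal_exp, ← Complex.ofReal_one, ← Complex.ofReal_sub,
    Complex.norm_real, Real.norm_eq_abs, abs_of_nonneg]
  · linarith [Real.add_one_le_exp (-(σ ^ α * |θ| ^ α))]
  · linarith [Real.exp_le_one_iff.2 (neg_nonpos.2 h0)]

/-- The tail beyond $r$ is controlled by the integral of $1-\hat\mu$ over $[-2/r,2/r]$, where the
integrand is at most $(2/r)^\alpha$. The constant is $\frac
r2\cdot(2/r)^\alpha\cdot\frac4r=2\cdot2^\alpha r^{-\alpha}$. -/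
lemma measureReal_abs_gt_le_rpow [IsProbabilityMeasure μ] (hα : 0 < α)
    (hμ : IsSymmStable α 1 μ) {r : ℝ} (hr : 0 < r) :
    μ.real {x | r < |x|} ≤ 2 * 2 ^ α * r ^ (-α) := by
  have hb : ‖∫ t in (-2 * r⁻¹)..(2 * r⁻¹), 1 - charFun μ t‖
      ≤ (2 * r⁻¹) ^ α * |2 * r⁻¹ - (-2 * r⁻¹)| := by
    refine intervalIntegral.norm_integral_le_of_norm_le_const fun t ht => ?_
    refine (norm_one_sub_charFun_le hμ zero_le_one t).trans ?_
    rw [Set.uIoc_of_le (by nlinarith [inv_pos.2 hr])] at ht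
    have : |t| ≤ 2 * r⁻¹ := abs_le.2 ⟨by linarith [ht.1], ht.2⟩
    rw [Real.one_rpow, one_mul]
    gcongr
  refine (measureReal_abs_gt_le_integral_charFun hr).trans ?_
  calc 2⁻¹ * r * ‖∫ t in (-2 * r⁻¹)..(2 * r⁻¹), 1 - charFun μ t‖
      ≤ 2⁻¹ * r * ((2 * r⁻¹) ^ α * |2 * r⁻¹ - (-2 * r⁻¹)|) := by gcongr
    _ = 2 * 2 ^ α * r ^ (-α) := by
      rw [abs_of_nonneg (by have := inv_pos.2 hr; linarith),
        Real.mul_rpow (by norm_num) (inv_pos.2 hr).le, Real.inv_rpow hr.le, Real.rpow_neg hr.le]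
      field_simp
      ring

/-- Layer-cake formula: on $(0,1]$ the tail is at most $1$ and $p-1>-1$; on $(1,\infty)$ the tail
bound leaves $t^{p-1-\alpha}$, integrable since $p<\alpha$. -/
lemma lintegral_abs_rpow_lt_top [IsProbabilityMeasure μ] (hp : 0 < p) (hpα : p < α)
    (hμ : IsSymmStable α 1 μ) : ∫⁻ x, ENNReal.ofReal (|x| ^ p) ∂μ < ∞ := by
  rw [lintegral_rpow_eq_lintegral_meas_lt_mul μ (Eventually.of_forall fun x => abs_nonneg x)
    (by fun_prop) hp]
  refine ENNReal.mul_lt_top ENNReal.ofReal_lt_top ?_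
  rw [← Set.Ioc_union_Ioi_eq_Ioi zero_le_one]
  refine (lintegral_union_le _ _ _).trans_lt (ENNReal.add_lt_top.2 ⟨?_, ?_⟩)
  · have hi : IntegrableOn (fun t : ℝ => t ^ (p - 1)) (Set.Ioc 0 1) := by
      rw [← intervalIntegrable_iff_integrableOn_Ioc_of_le zero_le_one]
      exact intervalIntegral.intervalIntegrable_rpow' (by linarith)
    refine lt_of_le_of_lt (lintegral_mono fun t => ?_) hi.lintegral_lt_top
    exact mul_le_of_le_one_left zero_le prob_le_one
  · have hi : IntegrableOn (fun t : ℝ => (2 * 2 ^ α) * t ^ (p - 1 - α)) (Set.Ioi 1) :=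
      (integrableOn_Ioi_rpow_of_lt (by linarith) one_pos).const_mul _
    refine lt_of_le_of_lt (setLIntegral_mono' measurableSet_Ioi fun t ht => ?_) hi.lintegral_lt_top
    have ht0 : (0 : ℝ) < t := one_pos.trans ht
    rw [← ofReal_measureReal, ← ENNReal.ofReal_mul measureReal_nonneg]
    refine ENNReal.ofReal_le_ofReal ?_
    calc μ.real {a | t < |a|} * t ^ (p - 1) ≤ 2 * 2 ^ α * t ^ (-α) * t ^ (p - 1) := by
          gcongr
          exact measureReal_abs_gt_le_rpow (hp.trans hpα) hμ ht0
      _ = _ := by rw [mul_assoc, ← Real.rpow_add ht0]; ring_nf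

end StableLaw

/-! ### Stable motion and the isometry on simple functions. -/

variable {Ω : Type*} [MeasurableSpace Ω] {P : Measure Ω} {α p d : ℝ} {L : ℝ → Ω → ℝ}

lemma lintegral_abs_rpow_eq_eLpNorm {Y : Ω → ℝ} (hp : 0 < p) :
    (∫⁻ ω, ENNReal.ofReal (|Y ω| ^ p) ∂P) ^ (1 / p) = eLpNorm Y (ENNReal.ofReal p) P := by
  rw [eLpNorm_eq_lintegral_rpow_enorm_toReal (by simpa using hp) ENNReal.ofReal_ne_top,
    ENNReal.toReal_ofReal hp.le]
  congr 1
  refine lintegral_congr fun ω => ?_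
  rw [← Real.norm_eq_abs, ← ENNReal.ofReal_rpow_of_nonneg (norm_nonneg _) hp.le, ofReal_norm]

lemma normB_eq (hp : 0 < p) (g : ℝ → ℝ) :
    normB α p d L P g = eLpNorm (L 1) (ENNReal.ofReal p) P *
      eLpNorm (rightFracInt d g) (ENNReal.ofReal α) volume := by
  rw [normB, lintegral_abs_rpow_eq_eLpNorm hp]

namespace IsStableMotion

lemma isSymmStable_one (hL : IsStableMotion α L P) : IsSymmStable α 1 (P.map (L 1)) := by
  have h := hL.law 0 1 zero_le_one
  have e : (fun ω => L 1 ω - L 0 ω) =ᵐ[P] L 1 := by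
    filter_upwards [hL.zero] with ω hω
    rw [hω, sub_zero]
  simpa [Measure.map_congr e] using h

lemma memLp_one [IsProbabilityMeasure P] (hL : IsStableMotion α L P) (hp : 0 < p) (hpα : p < α) :
    MemLp (L 1) (ENNReal.ofReal p) P := by
  refine ⟨(hL.measurable 1).aestronglyMeasurable, ?_⟩
  have : IsProbabilityMeasure (P.map (L 1)) :=
    Measure.isProbabilityMeasure_map (hL.measurable 1).aemeasurable
  rw [← lintegral_abs_rpow_eq_eLpNorm hp]
  refine ENNReal.rpow_lt_top_of_nonneg (by positivity) (ne_of_lt ?_)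
  have h := lintegral_abs_rpow_lt_top hp hpα hL.isSymmStable_one
  rwa [lintegral_map (by fun_prop) (hL.measurable 1)] at h

/-- If $L(1)$ vanished almost surely, its characteristic function at $1$ would be $1$ instead of
$e^{-1}$. This allows the factor $\|L(1)\|_p$ to be cancelled when a norm is zero. -/
lemma eLpNorm_one_ne_zero [IsProbabilityMeasure P] (hL : IsStableMotion α L P) (hp : 0 < p) :
    eLpNorm (L 1) (ENNReal.ofReal p) P ≠ 0 := by
  intro h
  rw [eLpNorm_eq_zero_iff (hL.measurable 1).aestronglyMeasurable (by simpa using hp)] at h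
  have h1 := hL.isSymmStable_one 1
  rw [Measure.map_congr h] at h1
  have h2 : P.map (0 : Ω → ℝ) = Measure.dirac 0 := by
    rw [show (0 : Ω → ℝ) = fun _ => 0 from rfl, Measure.map_const, measure_univ, one_smul]
  rw [h2, charFun_dirac] at h1
  simp only [inner_zero_left, Complex.ofReal_zero, zero_mul, Complex.exp_zero, Real.one_rpow,
    abs_one, mul_one, ← Complex.ofReal_neg, ← Complex.ofReal_exp] at h1
  have h3 : (1 : ℝ) = Real.exp (-1) := by exact_mod_cast h1
  have h4 : Real.exp (-1) < 1 := Real.exp_lt_one_iff.2 (by norm_num)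
  linarith

/-- Independence turns the characteristic function into a product, and the scale $(t-s)^{1/\alpha}$
raised to the power $\alpha$ is $t-s$. The exponents therefore add up to
$\|\phi\|_\alpha^\alpha|\theta|^\alpha$. -/
lemma charFun_integral (hL : IsStableMotion α L P) (hα : 0 < α) (φ : SimpleFn) (θ : ℝ) :
    charFun (P.map (φ.integral L)) θ =
      Complex.exp (-(((∑ i, |φ.a i| ^ α * (φ.t i.succ - φ.t i.castSucc)) * |θ| ^ α : ℝ) : ℂ)) := by
  have hind := hL.indep φ.n φ.t φ.strictMono.monotone
  have hind' : iIndepFun (fun (i : Fin φ.n) ω =>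
      φ.a i * (L (φ.t i.succ) ω - L (φ.t i.castSucc) ω)) P :=
    hind.comp (fun i x => φ.a i * x) (fun i => by fun_prop)
  have hm (t : ℝ) : Measurable (L t) := hL.measurable t
  have h := hind'.charFun_map_fun_sum_eq_prod (fun i => by fun_prop)
  have e : φ.integral L = fun ω => ∑ i, φ.a i * (L (φ.t i.succ) ω - L (φ.t i.castSucc) ω) := rfl
  rw [e, h, Finset.prod_apply]
  have hterm (i : Fin φ.n) : charFun (P.map fun ω =>
      φ.a i * (L (φ.t i.succ) ω - L (φ.t i.castSucc) ω)) θ =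
      Complex.exp (-((|φ.a i| ^ α * (φ.t i.succ - φ.t i.castSucc) * |θ| ^ α : ℝ) : ℂ)) := by
    have hlt : φ.t i.castSucc ≤ φ.t i.succ := φ.strictMono.monotone i.castSucc_lt_succ.le
    rw [charFun_map_mul_comp (by fun_prop), hL.law _ _ hlt]
    rw [← Real.rpow_mul (sub_nonneg.2 hlt), one_div_mul_cancel hα.ne', Real.rpow_one, abs_mul,
      Real.mul_rpow (abs_nonneg _) (abs_nonneg _)]
    ring_nf
  simp_rw [hterm]
  rw [← Complex.exp_sum]
  congr 1
  push_cast
  rw [Finset.sum_neg_distrib, Finset.sum_mul]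

end IsStableMotion

namespace SimpleFn

variable (φ : SimpleFn)

lemma disjoint_Ioc {i j : Fin φ.n} (hij : i ≠ j) {x : ℝ}
    (hi : x ∈ Set.Ioc (φ.t i.castSucc) (φ.t i.succ)) :
    x ∉ Set.Ioc (φ.t j.castSucc) (φ.t j.succ) := by
  intro hj
  have h1 : i.castSucc < j.succ := φ.strictMono.lt_iff_lt.1 (hi.1.trans_le hj.2)
  have h2 : j.castSucc < i.succ := φ.strictMono.lt_iff_lt.1 (hj.1.trans_le hi.2)
  refine hij (Fin.ext ?_)
  simp only [Fin.lt_def, Fin.val_castSucc, Fin.val_succ] at h1 h2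
  omega

lemma enorm_rpow_eq (hα : 0 < α) (x : ℝ) :
    ‖φ x‖ₑ ^ α = ∑ i : Fin φ.n, (Set.Ioc (φ.t i.castSucc) (φ.t i.succ)).indicator
      (fun _ => ENNReal.ofReal (|φ.a i| ^ α)) x := by
  by_cases hx : ∃ i : Fin φ.n, x ∈ Set.Ioc (φ.t i.castSucc) (φ.t i.succ)
  · obtain ⟨i, hi⟩ := hx
    rw [toFun, Finset.sum_eq_single i, Finset.sum_eq_single i, Set.indicator_of_mem hi,
      Set.indicator_of_mem hi, ← ofReal_norm, Real.norm_eq_abs,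
      ENNReal.ofReal_rpow_of_nonneg (abs_nonneg _) hα.le]
    all_goals first
      | exact fun j _ hj => Set.indicator_of_notMem (φ.disjoint_Ioc hj.symm hi) _
      | exact fun h => absurd (Finset.mem_univ i) h
  · push Not at hx
    rw [toFun, Finset.sum_eq_zero fun i _ => Set.indicator_of_notMem (hx i) _,
      Finset.sum_eq_zero fun i _ => Set.indicator_of_notMem (hx i) _]
    simp [hα]

lemma measurable_toFun : Measurable φ.toFun := by
  unfold toFun
  exact Finset.measurable_fun_sum _ fun i _ => measurable_const.indicator measurableSet_Ioc

lemma sum_nonneg : 0 ≤ ∑ i, |φ.a i| ^ α * (φ.t i.succ - φ.t i.castSucc) :=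
  Finset.sum_nonneg fun i _ => mul_nonneg (by positivity)
    (sub_nonneg.2 (φ.strictMono.monotone i.castSucc_lt_succ.le))

lemma eLpNorm_eq (hα : 0 < α) : eLpNorm φ (ENNReal.ofReal α) volume =
    ENNReal.ofReal ((∑ i, |φ.a i| ^ α * (φ.t i.succ - φ.t i.castSucc)) ^ (1 / α)) := by
  rw [eLpNorm_eq_lintegral_rpow_enorm_toReal (by simpa using hα) ENNReal.ofReal_ne_top,
    ENNReal.toReal_ofReal hα.le, ← ENNReal.ofReal_rpow_of_nonneg φ.sum_nonneg (by positivity)]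
  congr 1
  simp_rw [φ.enorm_rpow_eq hα]
  rw [lintegral_finsetSum _ fun i _ => measurable_const.indicator measurableSet_Ioc,
    ENNReal.ofReal_sum_of_nonneg fun i _ => mul_nonneg (by positivity)
    (sub_nonneg.2 (φ.strictMono.monotone i.castSucc_lt_succ.le))]
  refine Finset.sum_congr rfl fun i _ => ?_
  rw [lintegral_indicator_const measurableSet_Ioc, Real.volume_Ioc, ENNReal.ofReal_mul (by positivity)]

lemma memLp (hα : 0 < α) : MemLp φ (ENNReal.ofReal α) volume :=
  ⟨φ.measurable_toFun.aestronglyMeasurable, by rw [φ.eLpNorm_eq hα]; exact ENNReal.ofReal_lt_top⟩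

lemma measurable_integral (hL : IsStableMotion α L P) : Measurable (φ.integral L) := by
  have hm (t : ℝ) : Measurable (L t) := hL.measurable t
  unfold integral
  fun_prop

/-- The elementary integral is, up to the factor `‖L 1‖_p`, an isometry from `L^α` to `L^p`. -/
lemma eLpNorm_integral [IsProbabilityMeasure P] (hL : IsStableMotion α L P) (hα : 0 < α) :
    eLpNorm (φ.integral L) (ENNReal.ofReal p) P =
      eLpNorm (L 1) (ENNReal.ofReal p) P * eLpNorm φ (ENNReal.ofReal α) volume := by
  set c := (∑ i, |φ.a i| ^ α * (φ.t i.succ - φ.t i.castSucc)) ^ (1 / α) with hc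
  have hc0 : 0 ≤ c := Real.rpow_nonneg φ.sum_nonneg _
  have h1 := (hL.measurable 1)
  -- Equal characteristic functions: the elementary integral is distributed as $\|\phi\|_\alpha
  -- L(1)$.
  have hlaw : P.map (φ.integral L) = P.map (fun ω => c * L 1 ω) := by
    have := Measure.isProbabilityMeasure_map (μ := P) (φ.measurable_integral hL).aemeasurable
    have := Measure.isProbabilityMeasure_map (μ := P) (f := fun ω => c * L 1 ω) (by fun_prop)
    refine Measure.ext_of_charFun (funext fun θ => ?_)
    rw [hL.charFun_integral hα, charFun_map_mul_comp (by fun_prop), hL.isSymmStable_one, abs_mul,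
      Real.mul_rpow (abs_nonneg _) (abs_nonneg _), abs_of_nonneg hc0, hc,
      ← Real.rpow_mul φ.sum_nonneg, one_div_mul_cancel hα.ne', Real.rpow_one, Real.one_rpow,
      one_mul]
  have e1 := eLpNorm_map_measure (μ := P) (p := ENNReal.ofReal p) (g := (id : ℝ → ℝ))
    (f := φ.integral L) (by fun_prop) (φ.measurable_integral hL).aemeasurable
  have e2 := eLpNorm_map_measure (μ := P) (p := ENNReal.ofReal p) (g := (id : ℝ → ℝ))
    (f := fun ω => c * L 1 ω) (by fun_prop) (by fun_prop)
  rw [Function.id_comp] at e1 e2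
  rw [← e1, hlaw, e2, φ.eLpNorm_eq hα, mul_comm]
  have := eLpNorm_const_smul c (L 1) (ENNReal.ofReal p) P
  rw [← ofReal_norm, Real.norm_of_nonneg hc0] at this
  exact this

end SimpleFn

end

section

/-! ### Linear combinations of simple functions. -/

namespace SimpleFn

variable {Ω : Type*} (X : ℝ → Ω → ℝ)

/-- The indicator of `(u, v]`, together with the increment of `X` over it. -/
def increment (u v : ℝ) : (ℝ → ℝ) × (Ω → ℝ) :=
  ((Set.Ioc u v).indicator (fun _ => 1), X v - X u)

lemma increment_self (u : ℝ) : increment X u u = 0 := by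
  refine Prod.ext ?_ ?_
  · ext x
    simp [increment]
  · simp [increment]

lemma increment_add {u v w : ℝ} (huv : u ≤ v) (hvw : v ≤ w) :
    increment X u v + increment X v w = increment X u w := by
  refine Prod.ext ?_ ?_
  · simp only [increment, Prod.fst_add]
    rw [← Set.Ioc_union_Ioc_eq_Ioc huv hvw,
      Set.indicator_union_of_disjoint (Set.Ioc_disjoint_Ioc_of_le le_rfl)]
    rfl
  · simp [increment]

lemma mk_eq_sum (φ : SimpleFn) : ((φ : ℝ → ℝ), φ.integral X) =
    ∑ i, φ.a i • increment X (φ.t i.castSucc) (φ.t i.succ) := by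
  refine Prod.ext ?_ ?_
  · ext x
    simp [Prod.fst_sum, increment, toFun, Set.indicator_apply]
  · ext ω
    simp [Prod.snd_sum, increment, integral]

/-- The span of the increments over the cells of a grid. -/
def gridSpan {n : ℕ} (t : Fin (n + 1) → ℝ) : Submodule ℝ ((ℝ → ℝ) × (Ω → ℝ)) :=
  Submodule.span ℝ (Set.range fun i : Fin n => increment X (t i.castSucc) (t i.succ))

variable {X}

lemma exists_of_mem_gridSpan {n : ℕ} {t : Fin (n + 1) → ℝ} (ht : StrictMono t)
    {y : (ℝ → ℝ) × (Ω → ℝ)} (hy : y ∈ gridSpan X t) :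
    ∃ φ : SimpleFn, (φ : ℝ → ℝ) = y.1 ∧ φ.integral X = y.2 := by
  obtain ⟨a, rfl⟩ := (Submodule.mem_span_range_iff_exists_fun ℝ).1 hy
  have h := mk_eq_sum X ⟨n, t, ht, a⟩
  exact ⟨⟨n, t, ht, a⟩, congrArg Prod.fst h, congrArg Prod.snd h⟩

lemma increment_mem_gridSpan {n : ℕ} {t : Fin (n + 1) → ℝ} (ht : StrictMono t)
    {i j : Fin (n + 1)} (hij : i ≤ j) : increment X (t i) (t j) ∈ gridSpan X t := by
  induction j using Fin.induction with
  | zero =>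
    obtain rfl : i = 0 := le_antisymm hij (Fin.zero_le _)
    rw [increment_self]
    exact zero_mem _
  | succ j ih =>
    rcases hij.eq_or_lt with rfl | h
    · rw [increment_self]
      exact zero_mem _
    · have hi : i ≤ j.castSucc := Fin.le_castSucc_iff.2 h
      rw [← increment_add X (ht.monotone hi) (ht.monotone j.castSucc_lt_succ.le)]
      exact add_mem (ih hi) (Submodule.subset_span ⟨j, rfl⟩)

lemma mk_mem_gridSpan (φ : SimpleFn) {n : ℕ} {t : Fin (n + 1) → ℝ} (ht : StrictMono t)
    (h : Set.range φ.t ⊆ Set.range t) : ((φ : ℝ → ℝ), φ.integral X) ∈ gridSpan X t := by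
  rw [mk_eq_sum]
  refine sum_mem fun i _ => Submodule.smul_mem _ _ ?_
  obtain ⟨u, hu⟩ := h ⟨i.castSucc, rfl⟩
  obtain ⟨v, hv⟩ := h ⟨i.succ, rfl⟩
  rw [← hu, ← hv]
  refine increment_mem_gridSpan ht (ht.le_iff_le.1 ?_)
  rw [hu, hv]
  exact φ.strictMono.monotone i.castSucc_lt_succ.le

/-- Both functions are rewritten on the common refinement of their grids. Treating a function and
its elementary integral as one vector ensures that the same coefficients serve both identities. -/
lemma exists_add_smul (φ ψ : SimpleFn) (c : ℝ) : ∃ χ : SimpleFn,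
    (χ : ℝ → ℝ) = (φ : ℝ → ℝ) + c • (ψ : ℝ → ℝ) ∧
      χ.integral X = φ.integral X + c • ψ.integral X := by
  classical
  set s : Finset ℝ := Finset.univ.image φ.t ∪ Finset.univ.image ψ.t with hs
  have hpos : s.card = s.card - 1 + 1 := by
    have : 0 < s.card := Finset.card_pos.2 ⟨φ.t 0, by simp [hs]⟩
    omega
  have hr : Set.range (s.orderEmbOfFin hpos) = s := Finset.range_orderEmbOfFin s hpos
  have ht : StrictMono (s.orderEmbOfFin hpos) := (s.orderEmbOfFin hpos).strictMono
  have hφ := φ.mk_mem_gridSpan (X := X) ht (by rw [hr, hs]; simp)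
  have hψ := ψ.mk_mem_gridSpan (X := X) ht (by rw [hr, hs]; simp)
  exact exists_of_mem_gridSpan ht (add_mem hφ (Submodule.smul_mem _ c hψ))

end SimpleFn

/-! ### Density of simple functions in $L^q$ and in $L^1\cap L^q$. -/

section Density

/-- A continuous function is uniformly close to simple functions on a bounded interval. -/
lemma exists_simpleFn_dist_le {h : ℝ → ℝ} (hh : Continuous h) {N δ : ℝ} (hN : 0 < N) (hδ : 0 < δ) :
    ∃ φ : SimpleFn, (∀ x ∉ Set.Ioc (-N) N, φ x = 0) ∧ ∀ x ∈ Set.Ioc (-N) N, |φ x - h x| ≤ δ := by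
  have huc := isCompact_Icc.uniformContinuousOn_of_continuous
    (hh.continuousOn (s := Set.Icc (-N) N))
  obtain ⟨η, hη, hclose⟩ := Metric.uniformContinuousOn_iff_le.1 huc δ hδ
  obtain ⟨m, hm⟩ := exists_nat_gt (2 * N / η)
  have hm0 : (0 : ℝ) < m := (by positivity : 0 < 2 * N / η).trans hm
  have hw : 0 < 2 * N / m := by positivity
  have hwη : 2 * N / m < η := by
    rw [div_lt_iff₀ hη] at hm
    rw [div_lt_iff₀ hm0]
    linarith
  have hmw : m * (2 * N / m) = 2 * N := by field_simp
  -- Equal cells of width below the modulus $\eta$, with $h$ sampled at right endpoints.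
  let φ : SimpleFn := ⟨m, fun i => -N + i * (2 * N / m), fun i j hij => by
    have : (i : ℝ) < (j : ℝ) := by exact_mod_cast hij
    simpa using mul_lt_mul_of_pos_right this hw, fun i => h (-N + (i + 1 : ℕ) * (2 * N / m))⟩
  have hcell (i : Fin m) {x : ℝ} (hx : x ∈ Set.Ioc (φ.t i.castSucc) (φ.t i.succ)) :
      x ∈ Set.Ioc (-N) N ∧ -N + (i : ℕ) * (2 * N / m) < x ∧
        x ≤ -N + ((i : ℕ) + 1) * (2 * N / m) := by
    simp only [φ, Set.mem_Ioc, Fin.val_castSucc, Fin.val_succ, Nat.cast_add, Nat.cast_one] at hx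
    have hi : ((i : ℕ) : ℝ) + 1 ≤ m := by exact_mod_cast i.2
    have h1 : 0 ≤ ((i : ℕ) : ℝ) * (2 * N / m) := by positivity
    have h2 := mul_le_mul_of_nonneg_right hi hw.le
    exact ⟨⟨by linarith [hx.1], by linarith [hx.2]⟩, hx⟩
  refine ⟨φ, fun x hx => ?_, fun x hx => ?_⟩
  · exact Finset.sum_eq_zero fun i _ => Set.indicator_of_notMem (fun hi => hx (hcell i hi).1) _
  · have hy0 : 0 < (x + N) / (2 * N / m) := div_pos (by linarith [hx.1]) hw
    -- Cells are open on the left and closed on the right, so the cell index of $x$ is a ceiling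
    -- minus one.
    have hk0 : 0 < ⌈(x + N) / (2 * N / m)⌉₊ := Nat.ceil_pos.2 hy0
    obtain ⟨k, hk⟩ : ∃ k, ⌈(x + N) / (2 * N / m)⌉₊ = k + 1 := ⟨_, (Nat.succ_pred_eq_of_pos hk0).symm⟩
    have hup := Nat.le_ceil ((x + N) / (2 * N / m))
    have hlow := Nat.ceil_lt_add_one hy0.le
    rw [hk] at hup hlow
    push_cast at hup hlow
    rw [div_le_iff₀ hw] at hup
    have hlow' : (k : ℝ) < (x + N) / (2 * N / m) := by linarith
    rw [lt_div_iff₀ hw] at hlow'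
    have hkm : k < m := by
      have : (k : ℝ) * (2 * N / m) < m * (2 * N / m) := by rw [hmw]; linarith [hx.2]
      exact_mod_cast lt_of_mul_lt_mul_right this hw.le
    let i : Fin m := ⟨k, hkm⟩
    have hxi : x ∈ Set.Ioc (φ.t i.castSucc) (φ.t i.succ) := by
      simp only [φ, i, Set.mem_Ioc, Fin.val_castSucc, Fin.val_succ, Nat.cast_add, Nat.cast_one]
      exact ⟨by linarith, by linarith⟩
    have hval : φ x = h (-N + (k + 1) * (2 * N / m)) := by
      rw [SimpleFn.toFun, Finset.sum_eq_single (show Fin φ.n from i), Set.indicator_of_mem hxi]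
      · simp [φ, i]
      · exact fun j _ hj => Set.indicator_of_notMem (φ.disjoint_Ioc hj.symm hxi) _
      · exact fun h => absurd (Finset.mem_univ _) h
    rw [hval, ← Real.dist_eq]
    have hk1 : (k : ℝ) + 1 ≤ m := by exact_mod_cast hkm
    have h2 := mul_le_mul_of_nonneg_right hk1 hw.le
    have h1 : 0 ≤ (k : ℝ) * (2 * N / m) := by positivity
    refine hclose _ ⟨by linarith, by linarith⟩ _ ⟨hx.1.le, hx.2⟩ ?_
    rw [Real.dist_eq, abs_le]
    exact ⟨by linarith, by linarith⟩

variable {q : ℝ≥0∞} {g : ℝ → ℝ}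

/-- Replace $g$ by a continuous $h$ at cost $\varepsilon/2$, then $h$ by a uniformly close simple
function; the finite measure of the interval turns uniform closeness into $L^q$ closeness. -/
lemma exists_simpleFn_eLpNorm_restrict_le (hq1 : 1 ≤ q) (hq : q ≠ ∞) (hg : MemLp g q volume) {N : ℝ}
    (hN : 0 < N) {ε : ℝ≥0∞} (hε : ε ≠ 0) :
    ∃ φ : SimpleFn, (∀ x ∉ Set.Ioc (-N) N, φ x = 0) ∧
      eLpNorm (fun x => φ x - g x) q (volume.restrict (Set.Ioc (-N) N)) ≤ ε := by
  have hε2 : ε / 2 ≠ 0 := (ENNReal.half_pos hε).ne'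
  obtain ⟨h, -, hgh, hc, -⟩ := hg.exists_hasCompactSupport_eLpNorm_sub_le hq hε2
  set ν := volume.restrict (Set.Ioc (-N) N) with hν
  have hK : (ν Set.univ) ^ q.toReal⁻¹ ≠ ∞ := by
    refine ENNReal.rpow_ne_top_of_nonneg (by positivity) ?_
    simp [hν]
  obtain ⟨δ, hδ, hδε⟩ : ∃ δ : ℝ, 0 < δ ∧ (ν Set.univ) ^ q.toReal⁻¹ * ENNReal.ofReal δ ≤ ε / 2 := by
    have hlim : Tendsto (fun δ : ℝ => (ν Set.univ) ^ q.toReal⁻¹ * ENNReal.ofReal δ) (𝓝[>] 0)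
        (𝓝 0) := by
      have : Tendsto (fun δ : ℝ => ENNReal.ofReal δ) (𝓝[>] 0) (𝓝 0) := by
        simpa using (ENNReal.tendsto_ofReal (tendsto_id (α := ℝ) (x := 𝓝 0))).mono_left
          nhdsWithin_le_nhds
      simpa using ENNReal.Tendsto.const_mul this (Or.inr hK)
    obtain ⟨δ, hδ, hδ'⟩ := ((hlim.eventually (gt_mem_nhds hε2.bot_lt)).and
      self_mem_nhdsWithin).exists
    exact ⟨δ, hδ', hδ.le⟩
  obtain ⟨φ, hφ0, hφ⟩ := exists_simpleFn_dist_le hc hN hδ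
  refine ⟨φ, hφ0, ?_⟩
  have e : (fun x => φ x - g x) = (fun x => φ x - h x) + (h - g) := by
    ext x
    simp
  have hgm : AEStronglyMeasurable g ν := hg.1.restrict
  rw [e, ← ENNReal.add_halves ε]
  refine (eLpNorm_add_le (φ.measurable_toFun.aestronglyMeasurable.sub hc.aestronglyMeasurable)
    (hc.aestronglyMeasurable.sub hgm) hq1).trans (add_le_add ?_ ?_)
  · refine (eLpNorm_le_of_ae_bound (C := δ) ?_).trans hδε
    exact (ae_restrict_iff' measurableSet_Ioc).2 (Eventually.of_forall hφ)
  · rw [eLpNorm_sub_comm]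
    exact (eLpNorm_mono_measure _ Measure.restrict_le_self).trans hgh

/-- Choose $h$ of compact support close to $g$: beyond that support $g=g-h$. -/
lemma eventually_eLpNorm_indicator_compl_le (hq : q ≠ ∞) (hg : MemLp g q volume)
    {ε : ℝ≥0∞} (hε : ε ≠ 0) :
    ∀ᶠ N : ℝ in atTop, eLpNorm ((Set.Ioc (-N) N)ᶜ.indicator g) q volume ≤ ε := by
  obtain ⟨h, hs, hgh, hc, -⟩ := hg.exists_hasCompactSupport_eLpNorm_sub_le hq hε
  obtain ⟨R, hR⟩ := hs.isCompact.isBounded.subset_closedBall 0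
  filter_upwards [eventually_gt_atTop R] with N hN
  refine (eLpNorm_mono_ae (Eventually.of_forall fun x => ?_)).trans hgh
  by_cases hx : x ∈ (Set.Ioc (-N) N)ᶜ
  · have h0 : h x = 0 := by
      by_contra hne
      have := hR (subset_tsupport _ hne)
      rw [Metric.mem_closedBall, dist_zero_right, Real.norm_eq_abs, abs_le] at this
      exact hx ⟨by linarith [this.1], by linarith [this.2]⟩
    simp [Set.indicator_of_mem hx, h0]
  · simp [Set.indicator_of_notMem hx]

lemma eLpNorm_sub_le_restrict_add (hq1 : 1 ≤ q) (hg : AEStronglyMeasurable g volume) {N : ℝ}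
    {φ : SimpleFn} (hφ : ∀ x ∉ Set.Ioc (-N) N, φ x = 0) :
    eLpNorm (fun x => φ x - g x) q volume ≤
      eLpNorm (fun x => φ x - g x) q (volume.restrict (Set.Ioc (-N) N)) +
        eLpNorm ((Set.Ioc (-N) N)ᶜ.indicator g) q volume := by
  rw [← eLpNorm_indicator_eq_eLpNorm_restrict measurableSet_Ioc]
  have e : (fun x => φ x - g x) = (Set.Ioc (-N) N).indicator (fun x => φ x - g x) -
      (Set.Ioc (-N) N)ᶜ.indicator g := by
    ext x
    by_cases hx : x ∈ Set.Ioc (-N) N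
    · simp [hx]
    · simp [hx, hφ x hx]
  conv_lhs => rw [e]
  exact eLpNorm_sub_le ((φ.measurable_toFun.aestronglyMeasurable.sub hg).indicator measurableSet_Ioc)
    (hg.indicator measurableSet_Ioc.compl) hq1

lemma exists_seq_of_forall_exists_le {ι : Type*} {F : ι → ℝ≥0∞}
    (h : ∀ ε : ℝ≥0∞, ε ≠ 0 → ∃ i, F i ≤ ε) : ∃ u : ℕ → ι, Tendsto (fun k => F (u k)) atTop (𝓝 0) := by
  choose u hu using fun k : ℕ => h ((k : ℝ≥0∞)⁻¹) (by simp)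
  exact ⟨u, tendsto_of_tendsto_of_tendsto_of_le_of_le tendsto_const_nhds
    ENNReal.tendsto_inv_nat_nhds_zero (fun _ => zero_le) hu⟩

/-- Simple functions are dense in `L^q(ℝ)`. -/
lemma exists_seq_simpleFn_tendsto (hq1 : 1 ≤ q) (hq : q ≠ ∞) (hg : MemLp g q volume) :
    ∃ φ : ℕ → SimpleFn, Tendsto (fun k => eLpNorm (fun x => φ k x - g x) q volume) atTop (𝓝 0) := by
  refine exists_seq_of_forall_exists_le (F := fun φ : SimpleFn => eLpNorm (fun x => φ x - g x) q
    volume) fun ε hε => ?_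
  have hε2 : ε / 2 ≠ 0 := (ENNReal.half_pos hε).ne'
  obtain ⟨N, hN, hN0⟩ := ((eventually_eLpNorm_indicator_compl_le hq hg hε2).and
    (eventually_gt_atTop 0)).exists
  obtain ⟨φ, hφ0, hφ⟩ := exists_simpleFn_eLpNorm_restrict_le hq1 hq hg hN0 hε2
  refine ⟨φ, (eLpNorm_sub_le_restrict_add hq1 hg.1 hφ0).trans ?_⟩
  rw [← ENNReal.add_halves ε]
  exact add_le_add hφ hN

/-- Simple functions are dense in `L^1(ℝ) ∩ L^q(ℝ)`. -/
lemma exists_seq_simpleFn_tendsto_inter (hq1 : 1 ≤ q) (hq : q ≠ ∞) (hg₁ : MemLp g 1 volume)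
    (hg : MemLp g q volume) :
    ∃ φ : ℕ → SimpleFn, Tendsto (fun k => eLpNorm (fun x => φ k x - g x) 1 volume +
      eLpNorm (fun x => φ k x - g x) q volume) atTop (𝓝 0) := by
  refine exists_seq_of_forall_exists_le (F := fun φ : SimpleFn =>
    eLpNorm (fun x => φ x - g x) 1 volume + eLpNorm (fun x => φ x - g x) q volume) fun ε hε => ?_
  have hε2 : ε / 2 ≠ 0 := (ENNReal.half_pos hε).ne'
  have hε4 : ε / 2 / 2 ≠ 0 := (ENNReal.half_pos hε2).ne'
  obtain ⟨N, hN, hN₁, hN0⟩ := ((eventually_eLpNorm_indicator_compl_le hq hg hε4).and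
    ((eventually_eLpNorm_indicator_compl_le ENNReal.one_ne_top hg₁ hε4).and
    (eventually_gt_atTop 0))).exists
  set ν := volume.restrict (Set.Ioc (-N) N) with hν
  -- $K$ is the Hölder constant bounding the $L^1$ norm by the $L^q$ norm on $(-N,N]$, so a small
  -- enough $L^q$ error controls both norms with the same $\phi$.
  set K := ν Set.univ ^ (1 / (1 : ℝ≥0∞).toReal - 1 / q.toReal) with hKdef
  have hK : K ≠ ∞ := by
    refine ENNReal.rpow_ne_top_of_nonneg ?_ (by simp [hν])
    have : 1 ≤ q.toReal := by simpa using ENNReal.toReal_mono hq hq1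
    rw [ENNReal.toReal_one, sub_nonneg, div_le_div_iff₀ (by linarith) one_pos]
    linarith
  obtain ⟨φ, hφ0, hφ⟩ := exists_simpleFn_eLpNorm_restrict_le hq1 hq hg hN0
    (ε := min (ε / 2 / 2) (ε / 2 / 2 / K)) (by
      exact (lt_min hε4.bot_lt (ENNReal.div_pos hε4 hK)).ne')
  refine ⟨φ, ?_⟩
  rw [← ENNReal.add_halves ε]
  refine add_le_add ((eLpNorm_sub_le_restrict_add le_rfl hg.1 hφ0).trans ?_)
    ((eLpNorm_sub_le_restrict_add hq1 hg.1 hφ0).trans ?_)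
  all_goals rw [← ENNReal.add_halves (ε / 2)]
  · refine add_le_add ?_ hN₁
    refine (eLpNorm_le_eLpNorm_mul_rpow_measure_univ hq1
      (φ.measurable_toFun.aestronglyMeasurable.sub hg.1.restrict)).trans ?_
    exact (mul_le_mul_left (hφ.trans (min_le_right _ _)) K).trans (by
      rw [mul_comm]
      exact ENNReal.mul_div_le)
  · exact add_le_add (hφ.trans (min_le_left _ _)) hN

end Density

end

section

/-! ### Limits and Cauchy sequences of functions in $L^q$. -/

section LpTendsto

variable {β : Type*} [MeasurableSpace β] {ν : Measure β} {q : ℝ≥0∞} {u : ℕ → β → ℝ} {f : β → ℝ}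

lemma tendsto_eLpNorm_of_tendsto_sub (hq : 1 ≤ q) (hu : ∀ k, MemLp (u k) q ν) (hf : MemLp f q ν)
    (h : Tendsto (fun k => eLpNorm (u k - f) q ν) atTop (𝓝 0)) :
    Tendsto (fun k => eLpNorm (u k) q ν) atTop (𝓝 (eLpNorm f q ν)) := by
  have : Fact (1 ≤ q) := ⟨hq⟩
  have := ((Lp.tendsto_Lp_iff_tendsto_eLpNorm'' u hu f hf).2 h).enorm
  simpa only [Lp.enorm_toLp] using this

lemma tendsto_eLpNorm_sub_prod (hq : 1 ≤ q) (hu : ∀ k, MemLp (u k) q ν) (hf : MemLp f q ν)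
    (h : Tendsto (fun k => eLpNorm (u k - f) q ν) atTop (𝓝 0)) :
    Tendsto (fun n : ℕ × ℕ => eLpNorm (u n.1 - u n.2) q ν) atTop (𝓝 0) := by
  have : Fact (1 ≤ q) := ⟨hq⟩
  have := (Lp.cauchySeq_Lp_iff_cauchySeq_eLpNorm _).1
    ((Lp.tendsto_Lp_iff_tendsto_eLpNorm'' u hu f hf).2 h).cauchySeq
  refine this.congr fun n => eLpNorm_congr_ae ?_
  exact (hu n.1).coeFn_toLp.sub (hu n.2).coeFn_toLp

lemma exists_memLp_tendsto_of_cauchy (hq : 1 ≤ q) (hu : ∀ k, MemLp (u k) q ν)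
    (h : Tendsto (fun n : ℕ × ℕ => eLpNorm (u n.1 - u n.2) q ν) atTop (𝓝 0)) :
    ∃ f, MemLp f q ν ∧ Tendsto (fun k => eLpNorm (u k - f) q ν) atTop (𝓝 0) := by
  have : Fact (1 ≤ q) := ⟨hq⟩
  have hc : CauchySeq fun k => (hu k).toLp (u k) := by
    refine (Lp.cauchySeq_Lp_iff_cauchySeq_eLpNorm _).2 (h.congr fun n => eLpNorm_congr_ae ?_)
    exact (hu n.1).coeFn_toLp.symm.sub (hu n.2).coeFn_toLp.symm
  obtain ⟨F, hF⟩ := cauchySeq_tendsto_of_complete hc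
  refine ⟨F, Lp.memLp F, (Lp.tendsto_Lp_iff_tendsto_eLpNorm'' u hu F (Lp.memLp F)).1 ?_⟩
  rwa [Lp.toLp_coeFn]

lemma tendsto_eLpNorm_add_smul_sub {v : ℕ → β → ℝ} {g : β → ℝ} (hq : 1 ≤ q)
    (hu : ∀ k, MemLp (u k) q ν) (hf : MemLp f q ν) (hv : ∀ k, MemLp (v k) q ν) (hg : MemLp g q ν)
    (c : ℝ) (h : Tendsto (fun k => eLpNorm (u k - f) q ν) atTop (𝓝 0))
    (h' : Tendsto (fun k => eLpNorm (v k - g) q ν) atTop (𝓝 0)) :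
    Tendsto (fun k => eLpNorm ((u k + c • v k) - (f + c • g)) q ν) atTop (𝓝 0) := by
  have : Fact (1 ≤ q) := ⟨hq⟩
  refine (Lp.tendsto_Lp_iff_tendsto_eLpNorm'' (fun k => u k + c • v k)
    (fun k => (hu k).add ((hv k).const_smul c)) _ (hf.add (hg.const_smul c))).1 ?_
  exact ((Lp.tendsto_Lp_iff_tendsto_eLpNorm'' u hu f hf).2 h).add
    (((Lp.tendsto_Lp_iff_tendsto_eLpNorm'' v hv g hg).2 h').const_smul c)

end LpTendsto

/-! ### The stable integral as an isometry from $L^\alpha$ to $L^p$. -/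

variable {Ω : Type*} [MeasurableSpace Ω] {P : Measure Ω} {α p : ℝ} {L : ℝ → Ω → ℝ}

lemma one_le_ofReal {a : ℝ} (ha : 1 < a) : 1 ≤ ENNReal.ofReal a :=
  ENNReal.one_le_ofReal.2 ha.le

/-- `X ∈ L^p(P)` is the `L^p`-limit of the elementary integrals of some simple functions that
converge to `f` in `L^α(ℝ)`. -/
structure IsLpIntegral (α p : ℝ) (L : ℝ → Ω → ℝ) (P : Measure Ω) (f : ℝ → ℝ) (X : Ω → ℝ) :
    Prop where
  memLp_left : MemLp f (ENNReal.ofReal α) volume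
  memLp_right : MemLp X (ENNReal.ofReal p) P
  exists_seq : ∃ φ : ℕ → SimpleFn,
    Tendsto (fun k => eLpNorm ((φ k : ℝ → ℝ) - f) (ENNReal.ofReal α) volume) atTop (𝓝 0) ∧
    Tendsto (fun k => eLpNorm ((φ k).integral L - X) (ENNReal.ofReal p) P) atTop (𝓝 0)

lemma IsLpIntegral.congr_right {f : ℝ → ℝ} {X Y : Ω → ℝ} (hf : IsLpIntegral α p L P f X) (h : X =ᵐ[P] Y) : IsLpIntegral α p L P f Y := by
  refine ⟨hf.1, hf.2.ae_eq h, ?_⟩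
  obtain ⟨φ, hφ, hφ'⟩ := hf.exists_seq
  exact ⟨φ, hφ, hφ'.congr fun k => eLpNorm_congr_ae (EventuallyEq.rfl.sub h)⟩

variable [IsProbabilityMeasure P]

lemma SimpleFn.memLp_integral (φ : SimpleFn) (hL : IsStableMotion α L P) (hp : 0 < p)
    (hpα : p < α) : MemLp (φ.integral L) (ENNReal.ofReal p) P := by
  refine ⟨(φ.measurable_integral hL).aestronglyMeasurable, ?_⟩
  rw [φ.eLpNorm_integral hL (hp.trans hpα)]
  exact ENNReal.mul_lt_top (hL.memLp_one hp hpα).2 (φ.memLp (hp.trans hpα)).2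

lemma SimpleFn.eLpNorm_integral_sub (φ ψ : SimpleFn) (hL : IsStableMotion α L P) (hα : 0 < α) :
    eLpNorm (φ.integral L - ψ.integral L) (ENNReal.ofReal p) P =
      eLpNorm (L 1) (ENNReal.ofReal p) P *
        eLpNorm ((φ : ℝ → ℝ) - (ψ : ℝ → ℝ)) (ENNReal.ofReal α) volume := by
  obtain ⟨χ, h₁, h₂⟩ := SimpleFn.exists_add_smul (X := L) φ ψ (-1)
  rw [neg_one_smul, ← sub_eq_add_neg] at h₁ h₂
  rw [← h₁, ← h₂, χ.eLpNorm_integral hL hα]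

namespace IsLpIntegral

variable {f g : ℝ → ℝ} {X Y : Ω → ℝ}

lemma add_smul (hL : IsStableMotion α L P) (hp : 1 < p) (hpα : p < α)
    (hf : IsLpIntegral α p L P f X) (hg : IsLpIntegral α p L P g Y) (c : ℝ) :
    IsLpIntegral α p L P (f + c • g) (X + c • Y) := by
  have hp0 : 0 < p := one_pos.trans hp
  obtain ⟨φ, hφ, hφ'⟩ := hf.exists_seq
  obtain ⟨ψ, hψ, hψ'⟩ := hg.exists_seq
  choose χ h₁ h₂ using fun k => SimpleFn.exists_add_smul (X := L) (φ k) (ψ k) c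
  refine ⟨hf.1.add (hg.1.const_smul c), hf.2.add (hg.2.const_smul c), χ, ?_, ?_⟩
  · simp_rw [h₁]
    exact tendsto_eLpNorm_add_smul_sub (one_le_ofReal (hp.trans hpα))
      (fun k => (φ k).memLp (hp0.trans hpα)) hf.1 (fun k => (ψ k).memLp (hp0.trans hpα)) hg.1 c hφ hψ
  · simp_rw [h₂]
    exact tendsto_eLpNorm_add_smul_sub (one_le_ofReal hp)
      (fun k => (φ k).memLp_integral hL hp0 hpα) hf.2
      (fun k => (ψ k).memLp_integral hL hp0 hpα) hg.2 c hφ' hψ'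

lemma sub (hL : IsStableMotion α L P) (hp : 1 < p) (hpα : p < α)
    (hf : IsLpIntegral α p L P f X) (hg : IsLpIntegral α p L P g Y) :
    IsLpIntegral α p L P (f - g) (X - Y) := by
  simpa [sub_eq_add_neg] using hf.add_smul hL hp hpα hg (-1)

/-- The stable integral is, up to the factor `‖L 1‖_p`, an isometry from `L^α` to `L^p`. -/
lemma eLpNorm_eq (hL : IsStableMotion α L P) (hp : 1 < p) (hpα : p < α)
    (hf : IsLpIntegral α p L P f X) :
    eLpNorm X (ENNReal.ofReal p) P =
      eLpNorm (L 1) (ENNReal.ofReal p) P * eLpNorm f (ENNReal.ofReal α) volume := by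
  have hp0 : 0 < p := one_pos.trans hp
  obtain ⟨φ, hφ, hφ'⟩ := hf.exists_seq
  have h₁ := tendsto_eLpNorm_of_tendsto_sub (one_le_ofReal (hp.trans hpα))
    (fun k => (φ k).memLp (hp0.trans hpα)) hf.1 hφ
  have h₂ := tendsto_eLpNorm_of_tendsto_sub (one_le_ofReal hp)
    (fun k => (φ k).memLp_integral hL hp0 hpα) hf.2 hφ'
  refine tendsto_nhds_unique h₂ ?_
  simp_rw [fun k => (φ k).eLpNorm_integral (p := p) hL (hp0.trans hpα)]
  exact ENNReal.Tendsto.const_mul h₁ (Or.inr (hL.memLp_one hp0 hpα).2.ne)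

/-- One approximating sequence suffices for all: if $\phi_k$ is the given one, the isometry yields
$\|I(\psi_k)-X\|_p\le\|L(1)\|_p(\|\psi_k-f\|_\alpha+\|\phi_k-f\|_\alpha)+\|I(\phi_k)-X\|_p$, and
$L^p$ convergence implies convergence in measure. -/
lemma isStableIntegral (hL : IsStableMotion α L P) (hp : 1 < p) (hpα : p < α)
    (hf : IsLpIntegral α p L P f X) : IsStableIntegral α L P f X := by
  have hp0 : 0 < p := one_pos.trans hp
  have hα0 : 0 < α := hp0.trans hpα
  refine ⟨hf.2.1.aemeasurable, fun ψ hψ => ?_⟩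
  obtain ⟨φ, hφ, hφ'⟩ := hf.exists_seq
  have hm (η : SimpleFn) : AEStronglyMeasurable (η.integral L) P :=
    (η.measurable_integral hL).aestronglyMeasurable
  refine tendstoInMeasure_of_tendsto_eLpNorm (p := ENNReal.ofReal p) (by simpa using hp0)
    (fun k => hm _) hf.2.1 ?_
  have hsub : Tendsto (fun k => eLpNorm (L 1) (ENNReal.ofReal p) P *
      (eLpNorm ((ψ k : ℝ → ℝ) - f) (ENNReal.ofReal α) volume +
        eLpNorm ((φ k : ℝ → ℝ) - f) (ENNReal.ofReal α) volume) +
      eLpNorm ((φ k).integral L - X) (ENNReal.ofReal p) P) atTop (𝓝 0) := by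
    have := (ENNReal.Tendsto.const_mul (hψ.add hφ)
      (Or.inr (hL.memLp_one hp0 hpα).2.ne)).add hφ'
    simp only [add_zero, mul_zero] at this
    exact this
  refine tendsto_of_tendsto_of_tendsto_of_le_of_le tendsto_const_nhds hsub (fun _ => zero_le)
    fun k => ?_
  have e : (ψ k).integral L - X =
      ((ψ k).integral L - (φ k).integral L) + ((φ k).integral L - X) := by abel
  have e' : (ψ k : ℝ → ℝ) - (φ k : ℝ → ℝ) = ((ψ k : ℝ → ℝ) - f) - ((φ k : ℝ → ℝ) - f) := by abel
  have hψm := ((ψ k).memLp hα0).1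
  have hφm := ((φ k).memLp hα0).1
  calc eLpNorm ((ψ k).integral L - X) (ENNReal.ofReal p) P
      ≤ eLpNorm ((ψ k).integral L - (φ k).integral L) (ENNReal.ofReal p) P +
        eLpNorm ((φ k).integral L - X) (ENNReal.ofReal p) P := by
        rw [e]
        exact eLpNorm_add_le ((hm _).sub (hm _)) ((hm _).sub hf.2.1) (one_le_ofReal hp)
    _ ≤ _ := by
        rw [SimpleFn.eLpNorm_integral_sub _ _ hL hα0, e']
        gcongr
        exact eLpNorm_sub_le (hψm.sub hf.1.1) (hφm.sub hf.1.1) (one_le_ofReal (hp.trans hpα))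

/-- `stableIntegral` is an arbitrary choice of version; limits in measure are unique almost
everywhere, so the choice does not matter. -/
lemma stableIntegral_ae_eq (hL : IsStableMotion α L P) (hp : 1 < p) (hpα : p < α)
    (hf : IsLpIntegral α p L P f X) : stableIntegral α L P f =ᵐ[P] X := by
  have hX := hf.isStableIntegral hL hp hpα
  have hex : MemLp f (ENNReal.ofReal α) volume ∧ ∃ X : Ω → ℝ, IsStableIntegral α L P f X :=
    ⟨hf.1, X, hX⟩
  rw [stableIntegral, dif_pos hex]
  obtain ⟨φ, hφ, -⟩ := hf.exists_seq
  exact tendstoInMeasure_ae_unique (hex.2.choose_spec.2 φ hφ) (hX.2 φ hφ)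

end IsLpIntegral

/-- By the isometry, the elementary integrals of simple functions converging to $f$ are Cauchy in
$L^p$, which is complete. -/
lemma exists_isLpIntegral (hL : IsStableMotion α L P) (hp : 1 < p) (hpα : p < α) {f : ℝ → ℝ}
    (hf : MemLp f (ENNReal.ofReal α) volume) : ∃ X, IsLpIntegral α p L P f X := by
  have hp0 : 0 < p := one_pos.trans hp
  have hα0 : 0 < α := hp0.trans hpα
  obtain ⟨φ, hφ⟩ := exists_seq_simpleFn_tendsto (one_le_ofReal (hp.trans hpα))
    ENNReal.ofReal_ne_top hf
  have hc := tendsto_eLpNorm_sub_prod (one_le_ofReal (hp.trans hpα))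
    (fun k => (φ k).memLp hα0) hf hφ
  have hc' : Tendsto (fun n : ℕ × ℕ => eLpNorm ((φ n.1).integral L - (φ n.2).integral L)
      (ENNReal.ofReal p) P) atTop (𝓝 0) := by
    simp_rw [fun n : ℕ × ℕ => SimpleFn.eLpNorm_integral_sub (p := p) (φ n.1) (φ n.2) hL hα0]
    simpa using ENNReal.Tendsto.const_mul hc (Or.inr (hL.memLp_one hp0 hpα).2.ne)
  obtain ⟨X, hX, hlim⟩ := exists_memLp_tendsto_of_cauchy (one_le_ofReal hp)
    (fun k => (φ k).memLp_integral hL hp0 hpα) hc'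
  exact ⟨X, hf, hX, φ, hφ, hlim⟩

lemma isLpIntegral_stableIntegral (hL : IsStableMotion α L P) (hp : 1 < p) (hpα : p < α)
    {f : ℝ → ℝ} (hf : MemLp f (ENNReal.ofReal α) volume) :
    IsLpIntegral α p L P f (stableIntegral α L P f) := by
  obtain ⟨X, hX⟩ := exists_isLpIntegral hL hp hpα hf
  exact hX.congr_right (hX.stableIntegral_ae_eq hL hp hpα).symm

end

section

/-! ### Boundedness of the fractional integral from $L^1\cap L^\alpha$ to $L^\alpha$. -/

section Convolution

variable {α : ℝ}

/-- Minkowski's integral inequality for a weight `w` and a kernel all of whose sections have the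
same norm. -/
lemma lintegral_lintegral_mul_rpow_le (hα : 1 < α) {w : ℝ → ℝ≥0∞} {H : ℝ → ℝ → ℝ≥0∞} {c : ℝ≥0∞}
    (hw : Measurable w) (hH : Measurable (Function.uncurry H))
    (hc : ∀ s, ∫⁻ x, H x s ^ α = c) :
    (∫⁻ x, (∫⁻ s, w s * H x s) ^ α) ^ (1 / α) ≤ (∫⁻ s, w s) * c ^ (1 / α) := by
  have hα0 : 0 < α := by linarith
  have hconj : (α.conjExponent).HolderConjugate α := (Real.HolderConjugate.conjExponent hα).symm
  set β := α.conjExponent with hβ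
  have hβ0 : 0 < β := hconj.pos
  have hsum : 1 / β + 1 / α = 1 := by simpa using hconj.inv_add_inv_eq_one
  have hHx (x : ℝ) : Measurable (H x) := hH.of_uncurry_left
  set W := ∫⁻ s, w s with hW
  -- Hölder's inequality after splitting $w=w^{1/\beta}w^{1/\alpha}$; integrating in $x$ and
  -- exchanging the integrals then finishes.
  have hpt (x : ℝ) : (∫⁻ s, w s * H x s) ^ α ≤ W ^ (α / β) * ∫⁻ s, w s * H x s ^ α := by
    have h1 := ENNReal.lintegral_mul_le_Lp_mul_Lq volume hconj
      (f := fun s => w s ^ (1 / β)) (g := fun s => w s ^ (1 / α) * H x s)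
      (hw.pow_const _).aemeasurable ((hw.pow_const _).mul (hHx x)).aemeasurable
    have e1 (s : ℝ) : ((fun s => w s ^ (1 / β)) * fun s => w s ^ (1 / α) * H x s) s
        = w s * H x s := by
      simp only [Pi.mul_apply]
      rw [← mul_assoc, ← ENNReal.rpow_add_of_nonneg _ _ (by positivity) (by positivity), hsum,
        ENNReal.rpow_one]
    have e2 (s : ℝ) : (w s ^ (1 / β)) ^ β = w s := by
      rw [← ENNReal.rpow_mul, one_div_mul_cancel hβ0.ne', ENNReal.rpow_one]
    have e3 (s : ℝ) : (w s ^ (1 / α) * H x s) ^ α = w s * H x s ^ α := by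
      rw [ENNReal.mul_rpow_of_nonneg _ _ hα0.le, ← ENNReal.rpow_mul, one_div_mul_cancel hα0.ne',
        ENNReal.rpow_one]
    simp_rw [e1, e2, e3] at h1
    refine (ENNReal.rpow_le_rpow h1 hα0.le).trans (le_of_eq ?_)
    rw [ENNReal.mul_rpow_of_nonneg _ _ hα0.le, ← ENNReal.rpow_mul, ← ENNReal.rpow_mul,
      one_div_mul_cancel hα0.ne', ENNReal.rpow_one, one_div_mul_eq_div]
  have hmeas : Measurable (Function.uncurry fun x s => w s * H x s ^ α) :=
    (hw.comp measurable_snd).mul (hH.pow_const α)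
  have hint : ∫⁻ x, (∫⁻ s, w s * H x s) ^ α ≤ W ^ (α / β) * (W * c) := by
    refine (lintegral_mono hpt).trans ?_
    have hmeas' : Measurable fun x => ∫⁻ s, w s * H x s ^ α := hmeas.lintegral_prod_right'
    rw [lintegral_const_mul _ hmeas', lintegral_lintegral_swap hmeas.aemeasurable]
    gcongr
    have (s : ℝ) : ∫⁻ x, w s * H x s ^ α = w s * c := by
      rw [lintegral_const_mul _ (hH.of_uncurry_right.pow_const α), hc]
    simp_rw [this]
    rw [lintegral_mul_const _ hw]
  refine (ENNReal.rpow_le_rpow hint (by positivity)).trans (le_of_eq ?_)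
  rw [ENNReal.mul_rpow_of_nonneg _ _ (by positivity), ENNReal.mul_rpow_of_nonneg _ _ (by positivity),
    ← ENNReal.rpow_mul, ← mul_assoc, ← ENNReal.rpow_add_of_nonneg _ _ (by positivity)
    (by positivity), div_mul_div_comm, mul_one, mul_comm β, div_mul_cancel_left₀ hα0.ne',
    ← one_div, hsum, ENNReal.rpow_one]

end Convolution

section FractionalKernel

variable {α d : ℝ}

/-- The Riemann-Liouville kernel `s₊^(d-1)` near the origin. -/
def nearKernel (d : ℝ) : ℝ → ℝ≥0∞ :=
  (Set.Ioc 0 1).indicator fun s => ENNReal.ofReal (s ^ (d - 1))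

/-- The Riemann-Liouville kernel `s₊^(d-1)` away from the origin. -/
def farKernel (d : ℝ) : ℝ → ℝ≥0∞ :=
  (Set.Ioi 1).indicator fun s => ENNReal.ofReal (s ^ (d - 1))

lemma measurable_nearKernel : Measurable (nearKernel d) :=
  Measurable.indicator (by fun_prop) measurableSet_Ioc

lemma measurable_farKernel : Measurable (farKernel d) :=
  Measurable.indicator (by fun_prop) measurableSet_Ioi

lemma nearKernel_add_farKernel (s : ℝ) : nearKernel d s + farKernel d s =
    (Set.Ioi 0).indicator (fun s => ENNReal.ofReal (s ^ (d - 1))) s := by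
  rw [← Set.Ioc_union_Ioi_eq_Ioi zero_le_one,
    Set.indicator_union_of_disjoint Set.Ioc_disjoint_Ioi_same]
  rfl

lemma lintegral_nearKernel_ne_top (hd : 0 < d) : ∫⁻ s, nearKernel d s ≠ ∞ := by
  have hi : IntegrableOn (fun t : ℝ => t ^ (d - 1)) (Set.Ioc 0 1) := by
    rw [← intervalIntegrable_iff_integrableOn_Ioc_of_le zero_le_one]
    exact intervalIntegral.intervalIntegrable_rpow' (by linarith)
  simp_rw [nearKernel]
  rw [lintegral_indicator measurableSet_Ioc]
  exact hi.lintegral_lt_top.ne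

/-- The condition $d<1-1/\alpha$ says exactly that $(d-1)\alpha<-1$. -/
lemma lintegral_farKernel_rpow_ne_top (hα : 1 < α) (hd : d < 1 - 1 / α) :
    ∫⁻ s, farKernel d s ^ α ≠ ∞ := by
  have hα0 : 0 < α := by linarith
  have hexp : (d - 1) * α < -1 := by
    have : (d - 1) < -(1 / α) := by linarith
    calc (d - 1) * α < -(1 / α) * α := by gcongr
      _ = -1 := by field_simp
  have hi : IntegrableOn (fun t : ℝ => t ^ ((d - 1) * α)) (Set.Ioi 1) :=
    integrableOn_Ioi_rpow_of_lt hexp one_pos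
  have e (s : ℝ) : farKernel d s ^ α =
      (Set.Ioi 1).indicator (fun s => ENNReal.ofReal (s ^ ((d - 1) * α))) s := by
    by_cases hs : s ∈ Set.Ioi (1 : ℝ)
    · have hs0 : 0 ≤ s := (one_pos.trans hs).le
      rw [farKernel, Set.indicator_of_mem hs, Set.indicator_of_mem hs, Real.rpow_mul hs0,
        ENNReal.ofReal_rpow_of_nonneg (by positivity) hα0.le]
    · rw [farKernel, Set.indicator_of_notMem hs, Set.indicator_of_notMem hs,
        ENNReal.zero_rpow_of_pos hα0]
  simp_rw [e]
  rw [lintegral_indicator measurableSet_Ioi]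
  exact hi.lintegral_lt_top.ne

/-- The absolute version of the right-sided fractional integral. -/
def absFracInt (d : ℝ) (g : ℝ → ℝ) (x : ℝ) : ℝ≥0∞ :=
  ∫⁻ t in Set.Ioi x, ‖g t * (t - x) ^ (d - 1)‖ₑ

/-- The kernel is cut at $1$ because its near part is in $L^1$ and its far part in $L^\alpha$. The
near term is written with the kernel as weight and $g$ translated, the far term with $|g|$ as weight
and the kernel translated, as Minkowski's inequality requires. -/
lemma absFracInt_eq {g : ℝ → ℝ} (hg : Measurable g) (x : ℝ) : absFracInt d g x =
    (∫⁻ s, nearKernel d s * ‖g (x + s)‖ₑ) + ∫⁻ t, ‖g t‖ₑ * farKernel d (t - x) := by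
  have e : ∫⁻ s, nearKernel d s * ‖g (x + s)‖ₑ = ∫⁻ t, ‖g t‖ₑ * nearKernel d (t - x) := by
    rw [← lintegral_add_left_eq_self (fun t => ‖g t‖ₑ * nearKernel d (t - x)) x]
    simp [mul_comm]
  have hn : Measurable fun t => ‖g t‖ₑ * nearKernel d (t - x) :=
    hg.enorm.mul (measurable_nearKernel.comp (by fun_prop))
  rw [e, ← lintegral_add_left hn, absFracInt, ← lintegral_indicator measurableSet_Ioi]
  refine lintegral_congr fun t => ?_
  rw [← mul_add, nearKernel_add_farKernel]
  by_cases ht : t ∈ Set.Ioi x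
  · have ht' : t - x ∈ Set.Ioi (0 : ℝ) := Set.mem_Ioi.2 (sub_pos.2 ht)
    rw [Set.indicator_of_mem ht, Set.indicator_of_mem ht', enorm_mul,
      Real.enorm_of_nonneg (Real.rpow_nonneg (le_of_lt ht') _)]
  · have ht' : t - x ∉ Set.Ioi (0 : ℝ) := fun h => ht (Set.mem_Ioi.2 (sub_pos.1 h))
    rw [Set.indicator_of_notMem ht, Set.indicator_of_notMem ht', mul_zero]

lemma measurable_absFracInt {g : ℝ → ℝ} (hg : Measurable g) : Measurable (absFracInt d g) := by
  rw [funext fun x => absFracInt_eq (d := d) hg x]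
  refine Measurable.add ?_ ?_
  · refine Measurable.lintegral_prod_right' (f := fun z : ℝ × ℝ =>
      nearKernel d z.2 * ‖g (z.1 + z.2)‖ₑ) ?_
    exact (measurable_nearKernel.comp measurable_snd).mul (hg.comp (by fun_prop)).enorm
  · refine Measurable.lintegral_prod_right' (f := fun z : ℝ × ℝ =>
      ‖g z.2‖ₑ * farKernel d (z.2 - z.1)) ?_
    exact (hg.comp measurable_snd).enorm.mul (measurable_farKernel.comp (by fun_prop))

lemma absFracInt_congr {f g : ℝ → ℝ} (h : f =ᵐ[volume] g) : absFracInt d f = absFracInt d g := by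
  ext x
  refine lintegral_congr_ae (ae_restrict_of_ae ?_)
  filter_upwards [h] with t ht
  rw [ht]

/-- `g ↦ ∫_x^∞ |g(t)| (t-x)^(d-1) dt` is bounded from `L^1 ∩ L^α` to `L^α`. -/
lemma exists_lintegral_absFracInt_le (hα : 1 < α) (hd₁ : 0 < d) (hd₂ : d < 1 - 1 / α) :
    ∃ C : ℝ≥0∞, C ≠ ∞ ∧ ∀ g : ℝ → ℝ, MemB α g →
      (∫⁻ x, absFracInt d g x ^ α) ^ (1 / α) ≤
        C * (eLpNorm g 1 volume + eLpNorm g (ENNReal.ofReal α) volume) := by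
  have hα0 : 0 < α := by linarith
  refine ⟨(∫⁻ s, nearKernel d s) + (∫⁻ s, farKernel d s ^ α) ^ (1 / α),
    ENNReal.add_ne_top.2 ⟨lintegral_nearKernel_ne_top hd₁, ENNReal.rpow_ne_top_of_nonneg
    (by positivity) (lintegral_farKernel_rpow_ne_top hα hd₂)⟩, fun g hg => ?_⟩
  obtain ⟨g', hg', hgg'⟩ := hg.1.1
  rw [absFracInt_congr hgg', eLpNorm_congr_ae hgg', eLpNorm_congr_ae hgg']
  replace hg' := hg'.measurable
  -- Near part: $L^1$ kernel against $g\in L^\alpha$. The far part `h₂` pairs $g\in L^1$ with an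
  -- $L^\alpha$ kernel.
  have h₁ := lintegral_lintegral_mul_rpow_le hα (w := nearKernel d)
    (H := fun x s => ‖g' (x + s)‖ₑ) (c := ∫⁻ x, ‖g' x‖ₑ ^ α) measurable_nearKernel
    ((hg'.comp (by fun_prop : Measurable fun z : ℝ × ℝ => z.1 + z.2)).enorm)
    (fun s => lintegral_add_right_eq_self (fun x => ‖g' x‖ₑ ^ α) s)
  have h₂ := lintegral_lintegral_mul_rpow_le hα (w := fun t => ‖g' t‖ₑ)
    (H := fun x t => farKernel d (t - x)) (c := ∫⁻ s, farKernel d s ^ α) hg'.enorm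
    (measurable_farKernel.comp (by fun_prop : Measurable fun z : ℝ × ℝ => z.2 - z.1))
    (fun t => lintegral_sub_left_eq_self (fun x => farKernel d x ^ α) t)
  have eα : eLpNorm g' (ENNReal.ofReal α) volume = (∫⁻ x, ‖g' x‖ₑ ^ α) ^ (1 / α) := by
    rw [eLpNorm_eq_lintegral_rpow_enorm_toReal (by simpa using hα0) ENNReal.ofReal_ne_top,
      ENNReal.toReal_ofReal hα0.le]
  have e₁ : eLpNorm g' 1 volume = ∫⁻ x, ‖g' x‖ₑ := eLpNorm_one_eq_lintegral_enorm
  simp_rw [fun x => absFracInt_eq (d := d) hg' x]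
  have hm₁ : Measurable fun x => ∫⁻ s, nearKernel d s * ‖g' (x + s)‖ₑ := by
    refine Measurable.lintegral_prod_right' (f := fun z : ℝ × ℝ =>
      nearKernel d z.2 * ‖g' (z.1 + z.2)‖ₑ) ?_
    exact (measurable_nearKernel.comp measurable_snd).mul (hg'.comp (by fun_prop)).enorm
  have hm₂ : Measurable fun x => ∫⁻ t, ‖g' t‖ₑ * farKernel d (t - x) := by
    refine Measurable.lintegral_prod_right' (f := fun z : ℝ × ℝ =>
      ‖g' z.2‖ₑ * farKernel d (z.2 - z.1)) ?_
    exact (hg'.comp measurable_snd).enorm.mul (measurable_farKernel.comp (by fun_prop))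
  refine (ENNReal.lintegral_Lp_add_le hm₁.aemeasurable hm₂.aemeasurable hα.le).trans ?_
  rw [eα, e₁]
  refine (add_le_add h₁ h₂).trans ?_
  rw [add_mul, mul_comm (∫⁻ x, ‖g' x‖ₑ)]
  gcongr
  · exact le_add_self
  · exact le_self_add

lemma rightFracInt_congr {f g : ℝ → ℝ} (h : f =ᵐ[volume] g) :
    rightFracInt d f = rightFracInt d g := by
  ext x
  rw [rightFracInt, rightFracInt]
  congr 1
  refine integral_congr_ae (ae_restrict_of_ae ?_)
  filter_upwards [h] with t ht
  rw [ht]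

lemma aestronglyMeasurable_rightFracInt {g : ℝ → ℝ} (hg : AEStronglyMeasurable g volume) :
    AEStronglyMeasurable (rightFracInt d g) volume := by
  obtain ⟨g', hg', hgg'⟩ := hg
  rw [rightFracInt_congr hgg']
  have e : rightFracInt d g' = fun x => 1 / Real.Gamma d *
      ∫ t, {z : ℝ × ℝ | z.1 < z.2}.indicator (fun z => g' z.2 * (z.2 - z.1) ^ (d - 1)) (x, t) := by
    ext x
    rw [rightFracInt, ← integral_indicator measurableSet_Ioi]
    rfl
  rw [e]
  refine StronglyMeasurable.aestronglyMeasurable (StronglyMeasurable.const_mul ?_ _)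
  refine StronglyMeasurable.integral_prod_right' (f := {z : ℝ × ℝ | z.1 < z.2}.indicator
    (fun z => g' z.2 * (z.2 - z.1) ^ (d - 1))) (Measurable.stronglyMeasurable ?_)
  refine Measurable.indicator ?_ (measurableSet_lt measurable_fst measurable_snd)
  exact (hg'.measurable.comp measurable_snd).mul (by fun_prop)

lemma enorm_rightFracInt_le (g : ℝ → ℝ) (x : ℝ) :
    ‖rightFracInt d g x‖ₑ ≤ ‖1 / Real.Gamma d‖ₑ * absFracInt d g x := by
  rw [rightFracInt, enorm_mul]
  gcongr
  exact enorm_integral_le_lintegral_enorm _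

lemma exists_eLpNorm_rightFracInt_le (hα : 1 < α) (hd₁ : 0 < d) (hd₂ : d < 1 - 1 / α) :
    ∃ C : ℝ≥0∞, C ≠ ∞ ∧ ∀ g : ℝ → ℝ, MemB α g →
      eLpNorm (rightFracInt d g) (ENNReal.ofReal α) volume ≤
        C * (eLpNorm g 1 volume + eLpNorm g (ENNReal.ofReal α) volume) := by
  have hα0 : 0 < α := by linarith
  obtain ⟨C, hC, h⟩ := exists_lintegral_absFracInt_le hα hd₁ hd₂
  refine ⟨‖1 / Real.Gamma d‖ₑ * C, ENNReal.mul_ne_top enorm_ne_top hC, fun g hg => ?_⟩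
  obtain ⟨g', hg', hgg'⟩ := hg.1.1
  have hm : Measurable (absFracInt d g) := by
    rw [absFracInt_congr hgg']
    exact measurable_absFracInt hg'.measurable
  rw [eLpNorm_eq_lintegral_rpow_enorm_toReal (by simpa using hα0) ENNReal.ofReal_ne_top,
    ENNReal.toReal_ofReal hα0.le, mul_assoc]
  refine le_trans ?_ (mul_le_mul_right (h g hg) _)
  calc (∫⁻ x, ‖rightFracInt d g x‖ₑ ^ α) ^ (1 / α)
      ≤ (∫⁻ x, (‖1 / Real.Gamma d‖ₑ * absFracInt d g x) ^ α) ^ (1 / α) := by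
        gcongr with x
        exact enorm_rightFracInt_le g x
    _ = _ := by
        simp_rw [ENNReal.mul_rpow_of_nonneg _ _ hα0.le]
        rw [lintegral_const_mul _ (hm.pow_const α), ENNReal.mul_rpow_of_nonneg _ _ (by positivity),
          ← ENNReal.rpow_mul, mul_one_div_cancel hα0.ne', ENNReal.rpow_one]

namespace MemB

variable {f g : ℝ → ℝ}

lemma sub (hf : MemB α f) (hg : MemB α g) : MemB α (fun x => f x - g x) :=
  ⟨hf.1.sub hg.1, hf.2.sub hg.2⟩

lemma memLp_rightFracInt (hg : MemB α g) (hα : 1 < α) (hd₁ : 0 < d) (hd₂ : d < 1 - 1 / α) :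
    MemLp (rightFracInt d g) (ENNReal.ofReal α) volume := by
  obtain ⟨C, hC, h⟩ := exists_eLpNorm_rightFracInt_le hα hd₁ hd₂
  exact ⟨aestronglyMeasurable_rightFracInt hg.1.1,
    (h g hg).trans_lt (ENNReal.mul_lt_top hC.lt_top (ENNReal.add_lt_top.2 ⟨hg.1.2, hg.2.2⟩))⟩

/-- A function with finite $L^\alpha$ norm is finite almost everywhere; applied to `absFracInt`.
Linearity of `rightFracInt` needs this, since a divergent Bochner integral has the default value
$0$. -/
lemma ae_integrableOn (hg : MemB α g) (hα : 1 < α) (hd₁ : 0 < d) (hd₂ : d < 1 - 1 / α) :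
    ∀ᵐ x, IntegrableOn (fun t => g t * (t - x) ^ (d - 1)) (Set.Ioi x) := by
  have hα0 : 0 < α := by linarith
  obtain ⟨C, hC, h⟩ := exists_lintegral_absFracInt_le hα hd₁ hd₂
  obtain ⟨g', hg', hgg'⟩ := hg.1.1
  have hm : Measurable (absFracInt d g) := by
    rw [absFracInt_congr hgg']
    exact measurable_absFracInt hg'.measurable
  have hfin : ∫⁻ x, absFracInt d g x ^ α ≠ ∞ := by
    intro htop
    have := h g hg
    rw [htop, ENNReal.top_rpow_of_pos (by positivity), top_le_iff] at this
    exact ENNReal.mul_ne_top hC (ENNReal.add_ne_top.2 ⟨hg.1.2.ne, hg.2.2.ne⟩) this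
  filter_upwards [ae_lt_top (hm.pow_const α) hfin] with x hx
  refine ⟨(hg.1.1.mul ?_).restrict, ?_⟩
  · exact Measurable.aestronglyMeasurable (by fun_prop)
  · by_contra htop
    rw [hasFiniteIntegral_iff_enorm, not_lt, top_le_iff] at htop
    rw [absFracInt, htop, ENNReal.top_rpow_of_pos hα0] at hx
    exact lt_irrefl _ hx

lemma rightFracInt_sub (hf : MemB α f) (hg : MemB α g) (hα : 1 < α) (hd₁ : 0 < d)
    (hd₂ : d < 1 - 1 / α) :
    rightFracInt d (fun x => f x - g x) =ᵐ[volume] rightFracInt d f - rightFracInt d g := by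
  filter_upwards [hf.ae_integrableOn hα hd₁ hd₂, hg.ae_integrableOn hα hd₁ hd₂] with x hx hx'
  simp only [rightFracInt, Pi.sub_apply, sub_mul]
  rw [integral_sub hx hx', mul_sub]

end MemB

lemma memB_indicator (u v : ℝ) : MemB α ((Set.Ioc u v).indicator fun _ => 1) :=
  ⟨memLp_indicator_const _ measurableSet_Ioc _ (Or.inr (by simp)),
    memLp_indicator_const _ measurableSet_Ioc _ (Or.inr (by simp))⟩

lemma SimpleFn.memB (φ : SimpleFn) (hα : 1 < α) : MemB α φ :=
  ⟨by simpa using φ.memLp one_pos, φ.memLp (by linarith)⟩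

lemma intervalIntegrable_sub_rpow (hd : 0 < d) (x a v : ℝ) :
    IntervalIntegrable (fun t => (t - x) ^ (d - 1)) volume a v := by
  have := (intervalIntegral.intervalIntegrable_rpow' (a := a - x) (b := v - x)
    (by linarith : -1 < d - 1)).comp_sub_right x
  simpa using this

lemma integrableOn_indicator_mul (hd : 0 < d) (u v x : ℝ) : IntegrableOn
    (fun t => (Set.Ioc u v).indicator (fun _ => (1 : ℝ)) t * (t - x) ^ (d - 1)) (Set.Ioi x) := by
  have e : (fun t => (Set.Ioc u v).indicator (fun _ => (1 : ℝ)) t * (t - x) ^ (d - 1)) =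
      (Set.Ioc u v).indicator fun t => (t - x) ^ (d - 1) := by
    ext t
    by_cases ht : t ∈ Set.Ioc u v <;> simp [ht]
  rw [e]
  refine Integrable.integrableOn ?_
  rw [integrable_indicator_iff measurableSet_Ioc]
  rcases le_total u v with h | h
  · exact (intervalIntegrable_iff_integrableOn_Ioc_of_le h).1 (intervalIntegrable_sub_rpow hd x u v)
  · simp [Set.Ioc_eq_empty (not_lt.2 h)]

/-- The fractional integral of an indicator is an increment of the moving-average kernel. -/
lemma rightFracInt_indicator (hd : 0 < d) {u v : ℝ} (huv : u ≤ v) (x : ℝ) :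
    rightFracInt d ((Set.Ioc u v).indicator fun _ => 1) x =
      lfsmKernel d v x - lfsmKernel d u x := by
  have hint : ∫ t in Set.Ioi x, (Set.Ioc u v).indicator (fun _ => (1 : ℝ)) t * (t - x) ^ (d - 1) =
      ((max (v - x) 0) ^ d - (max (u - x) 0) ^ d) / d := by
    have e : (fun t => (Set.Ioc u v).indicator (fun _ => (1 : ℝ)) t * (t - x) ^ (d - 1)) =
        (Set.Ioc u v).indicator fun t => (t - x) ^ (d - 1) := by
      ext t
      by_cases ht : t ∈ Set.Ioc u v <;> simp [ht]
    rw [e, setIntegral_indicator measurableSet_Ioc]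
    have hset : Set.Ioi x ∩ Set.Ioc u v = Set.Ioc (max u x) v := by
      ext t
      simp only [Set.mem_inter_iff, Set.mem_Ioi, Set.mem_Ioc, max_lt_iff]
      tauto
    rw [hset]
    -- If $v\le x$ the domain is empty and both positive parts vanish; otherwise integrate the
    -- power, with lower limit $\max(u,x)-x=(u-x)_+$.
    rcases le_total v x with hv | hv
    · rw [Set.Ioc_eq_empty (not_lt.2 (hv.trans (le_max_right _ _))), max_eq_right (by linarith),
        max_eq_right (by linarith)]
      simp
    · rw [← intervalIntegral.integral_of_le (max_le huv hv),
        intervalIntegral.integral_comp_sub_right (fun s => s ^ (d - 1)),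
        integral_rpow (Or.inl (by linarith)), sub_add_cancel, max_eq_left (sub_nonneg.2 hv),
        ← max_sub_sub_right, sub_self]
  rw [rightFracInt, hint, lfsmKernel, lfsmKernel, Real.Gamma_add_one hd.ne']
  have := (Real.Gamma_pos_of_pos hd).ne'
  field_simp
  ring

lemma rightFracInt_simpleFn (hd : 0 < d) (φ : SimpleFn) : rightFracInt d φ =
    ∑ i, φ.a i • (lfsmKernel d (φ.t i.succ) - lfsmKernel d (φ.t i.castSucc)) := by
  ext x
  have e (t : ℝ) : φ t * (t - x) ^ (d - 1) = ∑ i, φ.a i * ((Set.Ioc (φ.t i.castSucc)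
      (φ.t i.succ)).indicator (fun _ => (1 : ℝ)) t * (t - x) ^ (d - 1)) := by
    rw [SimpleFn.toFun, Finset.sum_mul]
    refine Finset.sum_congr rfl fun i _ => ?_
    by_cases ht : t ∈ Set.Ioc (φ.t i.castSucc) (φ.t i.succ) <;> simp [ht]
  rw [rightFracInt]
  simp_rw [e]
  rw [integral_finsetSum _ fun i _ => (integrableOn_indicator_mul hd _ _ x).const_mul _,
    Finset.mul_sum, Finset.sum_apply]
  refine Finset.sum_congr rfl fun i _ => ?_
  rw [integral_const_mul, Pi.smul_apply, Pi.sub_apply, ← rightFracInt_indicator hd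
    (φ.strictMono.monotone i.castSucc_lt_succ.le), rightFracInt, smul_eq_mul]
  ring

lemma lfsmKernel_zero : lfsmKernel d 0 = 0 := by
  ext x
  simp [lfsmKernel]

/-- Up to sign the kernel is the fractional integral of the indicator of the interval between $0$
and $t$, so its integrability comes from the general bound. -/
lemma memLp_lfsmKernel (hα : 1 < α) (hd₁ : 0 < d) (hd₂ : d < 1 - 1 / α) (t : ℝ) :
    MemLp (lfsmKernel d t) (ENNReal.ofReal α) volume := by
  rcases le_total 0 t with ht | ht
  · convert (memB_indicator 0 t).memLp_rightFracInt hα hd₁ hd₂ using 1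
    ext x
    rw [rightFracInt_indicator hd₁ ht, lfsmKernel_zero, Pi.zero_apply, sub_zero]
  · convert ((memB_indicator t 0).memLp_rightFracInt hα hd₁ hd₂).neg using 1
    ext x
    rw [Pi.neg_apply, rightFracInt_indicator hd₁ ht, lfsmKernel_zero, Pi.zero_apply, zero_sub,
      neg_neg]

end FractionalKernel

end

/-! ### Integration against linear fractional stable motion. -/

section

variable {Ω : Type*} [MeasurableSpace Ω] {P : Measure Ω} {α p d : ℝ} {L M : ℝ → Ω → ℝ}

lemma equivB_refl (g : ℝ → ℝ) : EquivB α p d L P g g := by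
  have : rightFracInt d (fun x => g x - g x) = 0 := by
    ext x
    simp [rightFracInt]
  rw [EquivB, normB, this, eLpNorm_zero, mul_zero]

lemma IsLpIntegral.congr_left {f g : ℝ → ℝ} {X : Ω → ℝ} (hf : IsLpIntegral α p L P f X)
    (h : f =ᵐ[volume] g) : IsLpIntegral α p L P g X := by
  refine ⟨hf.1.ae_eq h, hf.2, ?_⟩
  obtain ⟨φ, hφ, hφ'⟩ := hf.exists_seq
  exact ⟨φ, hφ.congr fun k => eLpNorm_congr_ae (EventuallyEq.rfl.sub h), hφ'⟩

variable [IsProbabilityMeasure P]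

lemma isLpIntegral_zero (hL : IsStableMotion α L P) (hp : 1 < p) (hpα : p < α) :
    IsLpIntegral α p L P 0 0 := by
  have h := isLpIntegral_stableIntegral hL hp hpα
    (MemLp.zero' : MemLp (fun _ : ℝ => (0 : ℝ)) (ENNReal.ofReal α) volume)
  simpa using h.sub hL hp hpα h

lemma isLpIntegral_sum (hL : IsStableMotion α L P) (hp : 1 < p) (hpα : p < α) {ι : Type*}
    (s : Finset ι) (a : ι → ℝ) {f : ι → ℝ → ℝ} {X : ι → Ω → ℝ}
    (h : ∀ i, IsLpIntegral α p L P (f i) (X i)) :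
    IsLpIntegral α p L P (∑ i ∈ s, a i • f i) (∑ i ∈ s, a i • X i) := by
  classical
  induction s using Finset.induction_on with
  | empty => simpa using isLpIntegral_zero hL hp hpα
  | insert i s hi ih =>
    rw [Finset.sum_insert hi, Finset.sum_insert hi, add_comm, add_comm (a i • X i)]
    exact ih.add_smul hL hp hpα (h i) (a i)

/-- The elementary integral of `φ` with respect to a linear fractional stable motion is the stable
integral of the fractional integral of `φ`. -/
lemma isLpIntegral_rightFracInt_simpleFn (hL : IsStableMotion α L P) (hp : 1 < p) (hpα : p < α)
    (hd₁ : 0 < d) (hd₂ : d < 1 - 1 / α) (hM : ∀ t : ℝ, M t =ᵐ[P] lfsm α d L P t) (φ : SimpleFn) :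
    IsLpIntegral α p L P (rightFracInt d φ) (φ.integral M) := by
  have hM' (t : ℝ) : IsLpIntegral α p L P (lfsmKernel d t) (M t) :=
    (isLpIntegral_stableIntegral hL hp hpα
      (memLp_lfsmKernel (hp.trans hpα) hd₁ hd₂ t)).congr_right (hM t).symm
  have h := isLpIntegral_sum hL hp hpα Finset.univ φ.a fun i =>
    (hM' (φ.t i.succ)).sub hL hp hpα (hM' (φ.t i.castSucc))
  rw [← rightFracInt_simpleFn hd₁] at h
  convert h using 1
  ext ω
  simp [SimpleFn.integral]

lemma exists_seq_simpleFn_tendsto_normB (hL : IsStableMotion α L P) (hp : 1 < p) (hpα : p < α)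
    (hd₁ : 0 < d) (hd₂ : d < 1 - 1 / α) {g : ℝ → ℝ} (hg : MemB α g) :
    ∃ φ : ℕ → SimpleFn,
      Tendsto (fun k => normB α p d L P (fun x => φ k x - g x)) atTop (𝓝 0) := by
  have hp0 : 0 < p := one_pos.trans hp
  have hα : 1 < α := hp.trans hpα
  obtain ⟨C, hC, hbound⟩ := exists_eLpNorm_rightFracInt_le hα hd₁ hd₂
  obtain ⟨φ, hφ⟩ := exists_seq_simpleFn_tendsto_inter (one_le_ofReal hα) ENNReal.ofReal_ne_top
    hg.1 hg.2
  refine ⟨φ, ?_⟩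
  have hlim := ENNReal.Tendsto.const_mul (ENNReal.Tendsto.const_mul hφ (Or.inr hC))
    (Or.inr (hL.memLp_one hp0 hpα).2.ne)
  simp only [mul_zero] at hlim
  refine tendsto_of_tendsto_of_tendsto_of_le_of_le tendsto_const_nhds hlim (fun _ => zero_le)
    fun k => ?_
  simp only [normB_eq hp0]
  gcongr
  exact hbound _ (((φ k).memB hα).sub hg)

lemma integrable_abs_rpow_one (hL : IsStableMotion α L P) (hp : 0 < p) (hpα : p < α) :
    Integrable (fun ω => |L 1 ω| ^ p) P := by
  have h := (hL.memLp_one hp hpα).integrable_norm_rpow (by simpa using hp) ENNReal.ofReal_ne_top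
  simpa [ENNReal.toReal_ofReal hp.le] using h

lemma normB_eq_ofReal_integral (hL : IsStableMotion α L P) (hp : 0 < p) (hpα : p < α)
    (g : ℝ → ℝ) : normB α p d L P g = ENNReal.ofReal ((∫ ω, |L 1 ω| ^ p ∂P) ^ (1 / p)) *
      eLpNorm (rightFracInt d g) (ENNReal.ofReal α) volume := by
  rw [normB, ← ofReal_integral_eq_lintegral_ofReal (integrable_abs_rpow_one hL hp hpα)
    (Eventually.of_forall fun ω => by positivity),
    ENNReal.ofReal_rpow_of_nonneg (integral_nonneg fun ω => by positivity) (by positivity)]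

/-- Since $\|L(1)\|_p\ne0$, equivalence in $B_{\alpha,p}$ forces the fractional integrals to agree
almost everywhere. -/
lemma EquivB.rightFracInt_ae_eq (hL : IsStableMotion α L P) (hp : 1 < p) (hpα : p < α)
    (hd₁ : 0 < d) (hd₂ : d < 1 - 1 / α) {g h : ℝ → ℝ} (hg : MemB α g) (hh : MemB α h)
    (hgh : EquivB α p d L P g h) : rightFracInt d g =ᵐ[volume] rightFracInt d h := by
  have hp0 : 0 < p := one_pos.trans hp
  have hα : 1 < α := hp.trans hpα
  rw [EquivB, normB_eq hp0, mul_eq_zero, or_iff_right (hL.eLpNorm_one_ne_zero hp0),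
    eLpNorm_congr_ae (hg.rightFracInt_sub hh hα hd₁ hd₂),
    eLpNorm_eq_zero_iff ((hg.memLp_rightFracInt hα hd₁ hd₂).sub
    (hh.memLp_rightFracInt hα hd₁ hd₂)).1 (by simpa using one_pos.trans hα)] at hgh
  exact (sub_ae_eq_zero _ _).1 hgh

/-- The difference on the left is the stable integral of $I_-^d(\phi-h)$, so the isometry applies to
it. -/
lemma eLpNorm_integral_sub_eq_normB (hL : IsStableMotion α L P) (hp : 1 < p) (hpα : p < α)
    (hd₁ : 0 < d) (hd₂ : d < 1 - 1 / α) (hM : ∀ t : ℝ, M t =ᵐ[P] lfsm α d L P t) {h : ℝ → ℝ}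
    (hh : MemB α h) {X : Ω → ℝ} (hX : IsLpIntegral α p L P (rightFracInt d h) X) (φ : SimpleFn) :
    eLpNorm (fun ω => φ.integral M ω - X ω) (ENNReal.ofReal p) P =
      normB α p d L P (fun x => φ x - h x) := by
  have hα : 1 < α := hp.trans hpα
  have := ((isLpIntegral_rightFracInt_simpleFn hL hp hpα hd₁ hd₂ hM φ).sub hL hp hpα hX).eLpNorm_eq
    hL hp hpα
  rw [normB_eq (one_pos.trans hp), eLpNorm_congr_ae ((φ.memB hα).rightFracInt_sub hh hα hd₁ hd₂),
    ← this]
  rfl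

end

end FracStable

end

theorem theorem3p1 {Ω : Type*} [MeasurableSpace Ω] (P : Measure Ω) [IsProbabilityMeasure P]
    (α p d : ℝ) (hα₁ : 1 < α) (hα₂ : α < 2) (hp₁ : 1 < p) (hp₂ : p < α)
    (hd₁ : 0 < d) (hd₂ : d < 1 - 1 / α)
    (L : ℝ → Ω → ℝ) (hL : FracStable.IsStableMotion α L P)
    (M : ℝ → Ω → ℝ) (hM : ∀ t : ℝ, M t =ᵐ[P] FracStable.lfsm α d L P t)
    (g : ℝ → ℝ) (hg : FracStable.MemB α g) :
    (∃ φ : ℕ → FracStable.SimpleFn,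
      Tendsto (fun k => FracStable.normB α p d L P (fun x => φ k x - g x)) atTop (𝓝 0)) ∧
    ∃! I : Lp ℝ (ENNReal.ofReal p) P,
      ∀ h : ℝ → ℝ, FracStable.MemB α h → FracStable.EquivB α p d L P g h →
        (∀ φ : ℕ → FracStable.SimpleFn,
          Tendsto (fun k => FracStable.normB α p d L P (fun x => φ k x - h x)) atTop (𝓝 0) →
            (∀ k, MemLp ((φ k).integral M) (ENNReal.ofReal p) P) ∧
            Tendsto (fun k => eLpNorm (fun ω => (φ k).integral M ω - I ω) (ENNReal.ofReal p) P)
              atTop (𝓝 0)) ∧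
        eLpNorm I (ENNReal.ofReal p) P = FracStable.normB α p d L P h ∧
        FracStable.normB α p d L P h =
          ENNReal.ofReal ((∫ ω, |L 1 ω| ^ p ∂P) ^ (1 / p)) *
            eLpNorm (FracStable.rightFracInt d h) (ENNReal.ofReal α) volume ∧
        Integrable (fun ω => |L 1 ω| ^ p) P ∧
        MemLp (FracStable.rightFracInt d h) (ENNReal.ofReal α) volume := by
  have hp0 : 0 < p := one_pos.trans hp₁
  have hex := FracStable.exists_seq_simpleFn_tendsto_normB hL hp₁ hp₂ hd₁ hd₂ hg
  -- The candidate for $I_{M_d}(g)$ is the stable integral of $I_-^dg$.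
  have hJ := FracStable.isLpIntegral_stableIntegral hL hp₁ hp₂
    (hg.memLp_rightFracInt hα₁ hd₁ hd₂)
  have hI := hJ.congr_right hJ.memLp_right.coeFn_toLp.symm
  refine ⟨hex, hJ.memLp_right.toLp _, fun h hh hgh => ?_, fun J hJ' => ?_⟩
  · have hIh := hI.congr_left (hgh.rightFracInt_ae_eq hL hp₁ hp₂ hd₁ hd₂ hg hh)
    refine ⟨fun φ hφ => ⟨fun k => ?_, ?_⟩, ?_,
      FracStable.normB_eq_ofReal_integral hL hp0 hp₂ h,
      FracStable.integrable_abs_rpow_one hL hp0 hp₂, hIh.memLp_left⟩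
    · exact (FracStable.isLpIntegral_rightFracInt_simpleFn hL hp₁ hp₂ hd₁ hd₂ hM (φ k)).memLp_right
    · simpa only [FracStable.eLpNorm_integral_sub_eq_normB hL hp₁ hp₂ hd₁ hd₂ hM hh hIh] using hφ
    · rw [hIh.eLpNorm_eq hL hp₁ hp₂, FracStable.normB_eq hp0]
  · obtain ⟨φ, hφ⟩ := hex
    obtain ⟨hmem, hlim⟩ := (hJ' g hg (FracStable.equivB_refl g)).1 φ hφ
    have hlim' : Tendsto (fun k => eLpNorm (fun ω => (φ k).integral M ω -
        hJ.memLp_right.toLp _ ω) (ENNReal.ofReal p) P) atTop (𝓝 0) := by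
      refine hφ.congr fun k => ?_
      exact (FracStable.eLpNorm_integral_sub_eq_normB hL hp₁ hp₂ hd₁ hd₂ hM hg hI (φ k)).symm
    have hp1 := FracStable.one_le_ofReal hp₁
    have hm₁ := tendstoInMeasure_of_tendsto_eLpNorm (one_pos.trans_le hp1).ne'
      (fun k => (hmem k).1) (Lp.aestronglyMeasurable J) hlim
    have hm₂ := tendstoInMeasure_of_tendsto_eLpNorm (one_pos.trans_le hp1).ne'
      (fun k => (hmem k).1) (Lp.aestronglyMeasurable _) hlim'
    exact Lp.ext (tendstoInMeasure_ae_unique hm₁ hm₂)
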